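/- **Model.** For each $N\ge 1$ let $X=X_N=(x_{ij})_{1\le i,j\le N}$ be a real random matrix (the law of the entries may depend on $N$) whose entries have finite moments of all orders, and put $A=A_N=X/\sqrt N=(a_{ij})$. Assume: 1. $\mathbb E[x_{ij}]=0$ and $\mathbb E[x_{ij}^2]=1$ for all $i,j$. 2. The diagonal entries $x_{ii}$ and the pairs $(x_{ij},x_{ji})$, $i<j$, form a family of mutually independent random elements. 3. (Exploding moments with $\alpha=1$.) There are finite constants $C_{k,l}$ such that for all $k,l\ge 0$ with $k+l\ge 2$, $$\frac{\mathbb E[x_{ij}^k x_{ji}^l]}{N^{(k+l)/2-1}}\longrightarrow C_{k,l}\quad (N\to\infty),\ \text{uniformly in } i<j,$$ and for all $k\ge1$, $\ \mathbb E[|x_{ii}|^k]/N^{k/2-1}=O(1)$ uniformly in $i$. **Graphs.** For $k\ge1$ let $\mathcal P(k)$ be the set of partitions of $\{1,\dots,k\}$. For $\pi\in\mathcal P(k)$ let $T_\pi$ be the directed multigraph whose vertices are the blocks of $\pi$ and which has, for each $m\in\{1,\dots,k\}$, one edge from the block of $m$ to the block of $m+1$ (with $k+1$ identified with $1$). For a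 finite directed multigraph $T=(V,E)$ put $$\tau_N^e[T]=\frac1N\sum_{\substack{\phi:V\to\{1,\dots,N\}\\ \text{injective}}}\ \prod_{(u,v)\in E}a_{\phi(u)\phi(v)},\qquad Z_N(T)=\sqrt N\,\big(\tau_N^e[T]-\mathbb E\,\tau_N^e[T]\big).$$ Call $T$ a *thick tree* if it is connected, has no loops, has no pair of vertices joined by exactly one directed edge in total, and its underlying simple graph $(V,\mathcal E)$ (forget orientation and multiplicity) satisfies $|V|=|\mathcal E|+1$. Fix an arbitrary numbering of the vertices of every graph, and define $$\tau^e[T]=\prod_{k,l\ge0,\ k+l\ge2}C_{k,l}^{\,q_{k,l}}\ \text{ if $T$ is a thick tree},\qquad \tau^e[T]=0\ \text{ otherwise},$$ where $q_{k,l}$ is the number of vertex pairs $(i,j)$ with $i<j$ having exactly $k$ edges from $i$ to $j$ and $l$ edges from $j$ to $i$. For two such graphs $T_{\pi_1},T_{\pi_2}$ with vertex sets $V_1,V_2$, let $\mathcal P^{\#}(T_{\pi_1},T_{\pi_2})$ be the family of graphs $T_\sigma$ indexed by the partitions $\sigma$ of the disjoint union $V_1\sqcup V_2$ such that each block contains at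 most one vertex of $V_1$ and at most one vertex of $V_2$, and such that some edge of $T_{\pi_1}$ and some edge of $T_{\pi_2}$ are glued onto the same unordered pair of vertices; $T_\sigma$ is obtained from disjoint copies of the two graphs by merging the vertices in each block of $\sigma$ and keeping all edges. Each $\sigma$ is counted once. Put $$K(\pi_1,\pi_2)=\sum_{T\in\mathcal P^{\#}(T_{\pi_1},T_{\pi_2})}\tau^e[T].$$ **Theorem (CLT for the normalized traces, elliptic case).** As $N\to\infty$, the family $\big(Z_N(T_\pi)\big)_{\pi\in\bigcup_{k\ge1}\mathcal P(k)}$ converges, in the sense of convergence in distribution of all finite-dimensional marginals, to a centered Gaussian process $\big(z(T_\pi)\big)_{\pi\in\bigcup_{k\ge1}\mathcal P(k)}$ with $$\operatorname{Cov}\big(z(T_{\pi_1}),z(T_{\pi_2})\big)=K(\pi_1,\pi_2).$$ Moreover the asymptotic Wick formula holds: for all $r\ge0$ and all $\pi_1,\dots,\pi_r$, the product $\prod_{j=1}^r Z_N(T_{\pi_j})$ is integrable and $$\mathbb E\Big[\prod_{j=1}^r Z_N(T_{\pi_j})\Big]\longrightarrow\sum_{\mathfrak m}\ \prod_{\{i,j\}\in\mathfrak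 m}K(\pi_i,\pi_j),$$ where the sum runs over all pairings $\mathfrak m$ of $\{1,\dots,r\}$ (it is $0$ for odd $r$). -/

import Mathlib

open MeasureTheory ProbabilityTheory Filter Topology

noncomputable section

/-! ### Elliptic random matrices with exploding moments -/

/-- For each `N`, `X N` is an `N × N` real random matrix on the probability space `(Ω N, P N)`.
The sequence is elliptic with exploding moments, with rate `α` and limiting mixed moments
`C k l`. The moment asymptotics are uniform in the position of the entry. -/
structure IsEllipticExploding {Ω : ℕ → Type*} [∀ N, MeasurableSpace (Ω N)]
    (P : ∀ N, Measure (Ω N)) (X : ∀ N, Ω N → Matrix (Fin N) (Fin N) ℝ)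
    (α : ℝ) (C : ℕ → ℕ → ℝ) : Prop where
  measurable : ∀ N i j, Measurable fun ω => X N ω i j
  /-- all moments of all entries are finite -/
  integrable_pow : ∀ N i j (k : ℕ), Integrable (fun ω => X N ω i j ^ k) (P N)
  mean : ∀ N i j, ∫ ω, X N ω i j ∂(P N) = 0
  variance : ∀ N i j, ∫ ω, X N ω i j ^ 2 ∂(P N) = 1
  /-- The pairs `(x_ij, x_ji)`, `i < j`, together with the diagonal entries (which appear here
  as the pairs `(x_ii, x_ii)`) are mutually independent. -/
  indep : ∀ N, iIndepFun
    (fun (p : {p : Fin N × Fin N // p.1 ≤ p.2}) ω => (X N ω p.1.1 p.1.2, X N ω p.1.2 p.1.1))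
    (P N)
  alpha_pos : 0 < α
  offDiag : ∀ k l : ℕ, 2 ≤ k + l → ∀ ε > 0, ∀ᶠ N in atTop, ∀ i j : Fin N, i < j →
    |(∫ ω, X N ω i j ^ k * X N ω j i ^ l ∂(P N)) / (N : ℝ) ^ (((k : ℝ) + l) / 2 - α) - C k l| < ε
  diag : ∀ k : ℕ, 1 ≤ k → ∃ K : ℝ, ∀ᶠ N in atTop, ∀ i : Fin N,
    (∫ ω, |X N ω i i| ^ k ∂(P N)) / (N : ℝ) ^ ((k : ℝ) / 2 - α) ≤ K

/-! ### Directed multigraphs -/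

/-- A finite directed graph with multiple edges and loops. -/
structure Multidigraph where
  V : Type
  E : Type
  [fintypeV : Fintype V]
  [fintypeE : Fintype E]
  [decEqV : DecidableEq V]
  src : E → V
  tgt : E → V

attribute [instance] Multidigraph.fintypeV Multidigraph.fintypeE Multidigraph.decEqV

namespace Multidigraph

variable (T : Multidigraph)

/-- The number of edges from `u` to `v`. -/
def mult (u v : T.V) : ℕ := Fintype.card {e : T.E // T.src e = u ∧ T.tgt e = v}

/-- The underlying simple graph, forgetting orientation, multiplicity (and loops). -/
def toSimple : SimpleGraph T.V where
  Adj u v := u ≠ v ∧ ∃ e, (T.src e = u ∧ T.tgt e = v) ∨ (T.src e = v ∧ T.tgt e = u)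
  symm := ⟨fun _ _ h => ⟨h.1.symm, h.2.imp fun _ he => he.symm⟩⟩
  loopless := ⟨fun _ h => h.1 rfl⟩

/-- Thick tree: connected, loopless, no two vertices joined by one directed edge only, and
the underlying simple graph has one edge fewer than it has vertices. -/
def IsThickTree : Prop :=
  T.toSimple.Connected ∧
  (∀ e, T.src e ≠ T.tgt e) ∧
  (∀ u v, u ≠ v → T.mult u v + T.mult v u ≠ 1) ∧
  Fintype.card T.V = Nat.card T.toSimple.edgeSet + 1

/-- `q_{k,l}`: the number of ordered vertex pairs `(i, j)`, `i` before `j` in the numbering `ν`,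
with exactly `k` edges from `i` to `j` and `l` edges from `j` to `i`. -/
def q (ν : T.V ≃ Fin (Fintype.card T.V)) (k l : ℕ) : ℕ :=
  Fintype.card {p : T.V × T.V // ν p.1 < ν p.2 ∧ T.mult p.1 p.2 = k ∧ T.mult p.2 p.1 = l}

open Classical in
/-- `τ^e[T]`: the product of `C_{k,l} ^ q_{k,l}` over `k + l ≥ 2` if `T` is a thick tree, and
`0` otherwise. As `q_{k,l} = 0` when `k` or `l` exceeds the number of edges, the product
is taken over `k, l ≤ |E|`. -/
def tauLimit (C : ℕ → ℕ → ℝ) (ν : T.V ≃ Fin (Fintype.card T.V)) : ℝ :=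
  if T.IsThickTree then
    ∏ k ∈ Finset.range (Fintype.card T.E + 1), ∏ l ∈ Finset.range (Fintype.card T.E + 1),
      if 2 ≤ k + l then C k l ^ T.q ν k l else 1
  else 0

/-- `τ_N^e[T]` for an `N × N` matrix `A`: `1/N` times the sum over injective maps
`φ : V → [N]` of the product over edges `(u, v)` of `A (φ u) (φ v)`. -/
def tau {N : ℕ} (A : Matrix (Fin N) (Fin N) ℝ) : ℝ :=
  (1 / (N : ℝ)) * ∑ φ : T.V ↪ Fin N, ∏ e : T.E, A (φ (T.src e)) (φ (T.tgt e))

/-- `Z_N(T) = √N (τ_N^e[T] - E τ_N^e[T])`, with `A = X / √N`. -/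
def Z {Ω : ℕ → Type*} [∀ N, MeasurableSpace (Ω N)]
    (P : ∀ N, Measure (Ω N)) (X : ∀ N, Ω N → Matrix (Fin N) (Fin N) ℝ) (N : ℕ) (ω : Ω N) : ℝ :=
  √(N : ℝ) * (T.tau ((1 / √(N : ℝ)) • X N ω) - ∫ ω', T.tau ((1 / √(N : ℝ)) • X N ω') ∂(P N))

end Multidigraph

/-- The block of the partition `σ` containing the point `a`. -/
def blockOf {S : Type} [Fintype S] [DecidableEq S] (σ : Finpartition (Finset.univ : Finset S))
    (a : S) : {B // B ∈ σ.parts} :=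
  ⟨σ.part a, σ.part_mem.2 (Finset.mem_univ a)⟩

/-- The set of all partitions of `{1, …, k}`, `k` ranging over the integers `≥ 1`. -/
abbrev CyclePartition : Type := Σ k : ℕ+, Finpartition (Finset.univ : Finset (Fin (k : ℕ)))

/-- The graph `T_π`: its vertices are the blocks of `π`, and each `m` gives one edge from the
block of `m` to the block of `m + 1` (cyclically). -/
def partitionGraph (π : CyclePartition) : Multidigraph where
  V := {B // B ∈ π.2.parts}
  E := Fin (π.1 : ℕ)
  src m := blockOf π.2 m
  tgt m := blockOf π.2 (finRotate _ m)

/-! ### Gluings of two graphs -/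

namespace Multidigraph

variable (T₁ T₂ : Multidigraph)

/-- A partition of the disjoint union of the two vertex sets. -/
abbrev VertexPartition : Type := Finpartition (Finset.univ : Finset (T₁.V ⊕ T₂.V))

variable {T₁ T₂}

/-- The graph obtained from disjoint copies of `T₁` and `T₂` by merging the vertices that lie in
the same block of `σ`; all edges are kept, with multiplicity. -/
def glue (σ : VertexPartition T₁ T₂) : Multidigraph where
  V := {B // B ∈ σ.parts}
  E := T₁.E ⊕ T₂.E
  src := Sum.elim (fun e => blockOf σ (.inl (T₁.src e))) (fun e => blockOf σ (.inr (T₂.src e)))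
  tgt := Sum.elim (fun e => blockOf σ (.inl (T₁.tgt e))) (fun e => blockOf σ (.inr (T₂.tgt e)))

/-- `σ` belongs to `𝒫^#`: every block has at most one vertex of each graph, and some edge of
`T₁` and some edge of `T₂` are glued onto the same pair of vertices. -/
def IsEdgeGluing (σ : VertexPartition T₁ T₂) : Prop :=
  (∀ B ∈ σ.parts, (∀ u v, .inl u ∈ B → .inl v ∈ B → u = v) ∧
    (∀ u v, .inr u ∈ B → .inr v ∈ B → u = v)) ∧
  ∃ (e₁ : T₁.E) (e₂ : T₂.E),
    s((glue σ).src (.inl e₁), (glue σ).tgt (.inl e₁)) =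
      s((glue σ).src (.inr e₂), (glue σ).tgt (.inr e₂))

end Multidigraph

open Classical in
/-- The limiting covariance: the sum of `τ^e[T]` over the graphs `T` obtained by gluing `T_{π₁}`
and `T_{π₂}` along at least one common edge. -/
def limitCov (C : ℕ → ℕ → ℝ) (ν : ∀ T : Multidigraph, T.V ≃ Fin (Fintype.card T.V))
    (π₁ π₂ : CyclePartition) : ℝ :=
  ∑ σ : Multidigraph.VertexPartition (partitionGraph π₁) (partitionGraph π₂) with
    Multidigraph.IsEdgeGluing σ, (Multidigraph.glue σ).tauLimit C (ν (Multidigraph.glue σ))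

open Classical in
/-- The Wick sum of a kernel `K` at `t₁, …, t_r`: the sum over all pairings of `{1, …, r}` (given
as fixed-point-free involutions `s`) of the product of `K t_i t_j` over the pairs `{i, j}`. -/
def wickSum {I : Type} (K : I → I → ℝ) {r : ℕ} (t : Fin r → I) : ℝ :=
  ∑ s : Equiv.Perm (Fin r) with (∀ i, s i ≠ i ∧ s (s i) = i),
    ∏ i with i < s i, K (t i) (t (s i))

end

set_option linter.unusedSectionVars false


/-! ### Sums over functions, partitions and pairings -/

/-! Each `Z_N(T)` is `N^{-1/2}` times a sum, over injective labellings of the vertices, of centered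
monomials in the matrix entries. With `α = 1` every unordered pair of positions occurring in a
monomial costs one factor `O(1/N)`, however often it is used. A mixed moment of centered monomials
occupying `p` pairs is thus `O(N^{-p})`, while a coincidence pattern with `v` distinct vertices has
at most `N^v` labellings. The limit is decided by comparing `v` with `p`.

Covariance (`HasMomentLimits.tendsto_covariance`). Two labellings without a common pair give
independent factors and contribute 0; the others are grouped by the gluing they induce. The product
of the two means is negligible because a common pair is counted twice. The glued graph is connected,
so `v ≤ p + 1`. If it is not a thick tree, then either a pair crossed only once gives an exact 0, or
`v ≤ p` and the term vanishes in the limit. On a thick tree the expectation factorizes over the tree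
edges. The glued graph is Eulerian, so each tree edge is crossed equally often both ways; hence only
the constants `C k k` occur and the numbering `ν` is irrelevant.

Wick formula (`wick_error_le`, `HasMomentLimits.tendsto_wickSum`). For one tuple of labellings of
`r` graphs, an isolated graph makes both sides vanish. Otherwise every component of the union
contains at least two graphs, so there are at most `r/2` components and `v ≤ p + r/2`. If equality
fails, the term is smaller by `N^{-1/2}`; if it holds, the graphs are perfectly matched and the
moment factorizes exactly along that pairing, the only one contributing.

Law. The limiting kernel is a limit of covariances, hence symmetric and positive semidefinite, and a
Gaussian process with this kernel is built from iid Gaussians by Gram–Schmidt. By the Wick formula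
linear combinations have asymptotically Gaussian moments; a Taylor estimate turns this into
convergence of characteristic functions, and Lévy's continuity theorem concludes. -/

lemma blockOf_eq_iff {W : Type} [Fintype W] [DecidableEq W]
    (σ : Finpartition (Finset.univ : Finset W)) (a b : W) :
    blockOf σ a = blockOf σ b ↔ b ∈ σ.part a := by
  rw [blockOf, blockOf, Subtype.mk.injEq]
  constructor
  · intro h
    rw [h]
    exact σ.mem_part (Finset.mem_univ b)
  · intro h
    exact (σ.part_eq_of_mem (σ.part_mem.2 (Finset.mem_univ a)) h).symm

lemma blockOf_surjective {W : Type} [Fintype W] [DecidableEq W]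
    (σ : Finpartition (Finset.univ : Finset W)) : Function.Surjective (blockOf σ) := by
  rintro ⟨B, hB⟩
  obtain ⟨a, ha⟩ := σ.nonempty_of_mem_parts hB
  exact ⟨a, Subtype.ext (σ.part_eq_of_mem hB ha)⟩

lemma finpartition_ext_blockOf {W : Type} [Fintype W] [DecidableEq W]
    {σ τ : Finpartition (Finset.univ : Finset W)}
    (h : ∀ a b, blockOf σ a = blockOf σ b ↔ blockOf τ a = blockOf τ b) : σ = τ := by
  have hpart : ∀ a, σ.part a = τ.part a := by
    intro a
    ext b
    rw [← blockOf_eq_iff, ← blockOf_eq_iff, h]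
  have key : ∀ (σ τ : Finpartition (Finset.univ : Finset W)), (∀ a, σ.part a = τ.part a) →
      ∀ B ∈ σ.parts, B ∈ τ.parts := by
    intro σ τ hpart B hB
    obtain ⟨a, ha⟩ := σ.nonempty_of_mem_parts hB
    rw [← σ.part_eq_of_mem hB ha, hpart]
    exact τ.part_mem.2 (Finset.mem_univ a)
  ext B
  exact ⟨key σ τ hpart B, key τ σ (fun a => (hpart a).symm) B⟩

/-- Every function on `W` factors uniquely as an embedding of the blocks of a partition. -/
lemma sum_functions_eq_sum_finpartition {W α : Type} [Fintype W] [DecidableEq W] [Fintype α]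
    [DecidableEq α] (F : (W → α) → ℝ) :
    ∑ f, F f = ∑ σ : Finpartition (Finset.univ : Finset W),
      ∑ ψ : {B // B ∈ σ.parts} ↪ α, F (fun a => ψ (blockOf σ a)) := by
  classical
  rw [← Fintype.sum_sigma' (f := fun (σ : Finpartition (Finset.univ : Finset W))
    (ψ : {B // B ∈ σ.parts} ↪ α) => F (fun a => ψ (blockOf σ a)))]
  symm
  refine Fintype.sum_bijective
    (fun x : Σ σ : Finpartition (Finset.univ : Finset W), ({B // B ∈ σ.parts} ↪ α) =>
      fun a => x.2 (blockOf x.1 a)) ⟨?_, ?_⟩ _ _ (fun _ => rfl)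
  · rintro ⟨σ, ψ⟩ ⟨τ, χ⟩ h
    have h' : ∀ a, ψ (blockOf σ a) = χ (blockOf τ a) := fun a => congrFun h a
    have : σ = τ := by
      apply finpartition_ext_blockOf
      intro a b
      rw [← ψ.injective.eq_iff, h', h', χ.injective.eq_iff]
    subst this
    congr
    ext B
    obtain ⟨a, rfl⟩ := blockOf_surjective σ B
    exact h' a
  · intro f
    let σ := Finpartition.ofSetoid (Setoid.ker f)
    have hσ : ∀ a b, blockOf σ a = blockOf σ b ↔ f a = f b := by
      intro a b
      rw [blockOf_eq_iff, Finpartition.mem_part_ofSetoid_iff_rel]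
      rfl
    let g := Function.surjInv (blockOf_surjective σ)
    have hg : ∀ B, blockOf σ (g B) = B := Function.surjInv_eq (blockOf_surjective σ)
    refine ⟨⟨σ, ⟨fun B => f (g B), ?_⟩⟩, ?_⟩
    · intro B B' h
      rw [← hg B, ← hg B', hσ]
      exact h
    · funext a
      exact (hσ _ _).1 (hg _)

lemma sum_embedding_eq_sum_ite {V α : Type} [Fintype V] [DecidableEq V] [Fintype α] [DecidableEq α]
    (g : (V → α) → ℝ) :
    ∑ φ : V ↪ α, g φ = ∑ f : V → α, if Function.Injective f then g f else 0 := by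
  classical
  rw [← Finset.sum_filter]
  refine Finset.sum_bij (fun φ _ => ⇑φ) ?_ ?_ ?_ ?_
  · intro φ _
    simp [φ.injective]
  · intro φ _ ψ _ h
    exact DFunLike.coe_injective h
  · intro f hf
    exact ⟨⟨f, by simpa using hf⟩, Finset.mem_univ _, rfl⟩
  · intro φ _
    rfl

/-- The sum of `n ^ (-#(image f))` over all functions `f : W → [n]` is bounded in `n`. -/
lemma sum_inv_pow_card_image_le {W : Type} [Fintype W] [DecidableEq W] (N : ℕ) :
    ∑ f : W → Fin N, ((N : ℝ) ^ (Finset.univ.image f).card)⁻¹ ≤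
      Fintype.card (Finpartition (Finset.univ : Finset W)) := by
  have hone : (Fintype.card (Finpartition (Finset.univ : Finset W)) : ℝ)
      = ∑ _σ : Finpartition (Finset.univ : Finset W), 1 := by simp
  rw [sum_functions_eq_sum_finpartition, hone]
  refine Finset.sum_le_sum fun σ _ => ?_
  have h : ∀ ψ : {B // B ∈ σ.parts} ↪ Fin N,
      (Finset.univ.image fun a => ψ (blockOf σ a)).card = Fintype.card {B // B ∈ σ.parts} := by
    intro ψ
    have : (Finset.univ.image fun a => ψ (blockOf σ a)) = Finset.univ.map ψ := by
      ext x
      simp only [Finset.mem_image, Finset.mem_map, Finset.mem_univ, true_and]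
      constructor
      · rintro ⟨a, rfl⟩
        exact ⟨_, rfl⟩
      · rintro ⟨B, rfl⟩
        obtain ⟨a, rfl⟩ := blockOf_surjective σ B
        exact ⟨a, rfl⟩
    rw [this, Finset.card_map, Finset.card_univ]
  simp_rw [h]
  rw [Finset.sum_const, Finset.card_univ, nsmul_eq_mul]
  have hc : (Fintype.card ({B // B ∈ σ.parts} ↪ Fin N) : ℝ) ≤
      (N : ℝ) ^ Fintype.card {B // B ∈ σ.parts} := by
    rw [Fintype.card_embedding_eq, Fintype.card_fin]
    exact_mod_cast Nat.descFactorial_le_pow _ _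
  -- For `N = 0` the power can vanish; its inverse is then 0 by convention and the bound is trivial.
  rcases (pow_nonneg (Nat.cast_nonneg N) _ : (0:ℝ) ≤ (N : ℝ) ^ Fintype.card {B // B ∈ σ.parts}).eq_or_lt
    with h0 | h0
  · rw [← h0]; simp
  · exact (mul_le_mul_of_nonneg_right hc (inv_nonneg.2 h0.le)).trans
      (mul_inv_cancel₀ h0.ne').le

/-- Fixed-point-free involutions, i.e. pairings. -/
def IsPairing {r : ℕ} (s : Equiv.Perm (Fin r)) : Prop := ∀ i, s i ≠ i ∧ s (s i) = i

lemma IsPairing.lt_iff {r : ℕ} {s : Equiv.Perm (Fin r)} (hs : IsPairing s) (i : Fin r) :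
    s i < s (s i) ↔ ¬ i < s i := by
  rw [(hs i).2, not_lt]
  exact ⟨le_of_lt, fun h => lt_of_le_of_ne h (hs i).1⟩

lemma IsPairing.prod_eq {r : ℕ} {s : Equiv.Perm (Fin r)} (hs : IsPairing s) (f : Fin r → ℝ) :
    ∏ i, f i = ∏ i with i < s i, f i * f (s i) := by
  rw [Finset.prod_mul_distrib, ← Finset.prod_filter_mul_prod_filter_not Finset.univ (fun i => i < s i)]
  congr 1
  symm
  refine Finset.prod_bij (fun i _ => s i) ?_ (fun _ _ _ _ h => s.injective h) ?_ (fun _ _ => rfl)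
  · intro i hi
    simp only [Finset.mem_filter, Finset.mem_univ, true_and] at hi ⊢
    rw [hs.lt_iff]
    exact not_not.2 hi
  · intro i hi
    simp only [Finset.mem_filter, Finset.mem_univ, true_and] at hi
    refine ⟨s i, ?_, (hs i).2⟩
    simp only [Finset.mem_filter, Finset.mem_univ, true_and]
    rwa [hs.lt_iff]

lemma IsPairing.two_mul_card {r : ℕ} {s : Equiv.Perm (Fin r)} (hs : IsPairing s) :
    2 * (Finset.univ.filter fun i => i < s i).card = r := by
  have h := hs.prod_eq (fun _ => (2 : ℝ))
  simp only [Finset.prod_const, Finset.card_univ, Fintype.card_fin] at h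
  rw [← pow_two, ← pow_mul] at h
  have := pow_right_injective₀ (by norm_num : (0:ℝ) < 2) (by norm_num) h
  exact this.symm

/-- Sums over tuples of products over the pairs of a pairing factorize. -/
lemma IsPairing.prod_sum_eq {r : ℕ} {s : Equiv.Perm (Fin r)} (hs : IsPairing s)
    {A : Fin r → Type} [∀ i, Fintype (A i)] (g : ∀ i, A i → A (s i) → ℝ) :
    ∏ i with i < s i, ∑ a, ∑ b, g i a b = ∑ φ : ∀ i, A i, ∏ i with i < s i, g i (φ i) (φ (s i)) := by
  classical
  have h1 : ∏ i with i < s i, ∑ a, ∑ b, g i a b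
      = ∏ i : {i // i < s i}, ∑ x : A i × A (s i), g i x.1 x.2 := by
    rw [← Finset.prod_subtype_eq_prod_filter, Finset.subtype_univ]
    refine Finset.prod_congr rfl fun i _ => ?_
    rw [Fintype.sum_prod_type]
  have h2 : ∀ φ : ∀ i, A i, ∏ i with i < s i, g i (φ i) (φ (s i))
      = ∏ i : {i // i < s i}, g i (φ i) (φ (s i)) := by
    intro φ
    rw [← Finset.prod_subtype_eq_prod_filter, Finset.subtype_univ]
  simp_rw [h2]
  rw [h1, Finset.prod_univ_sum, Fintype.piFinset_univ]
  symm
  refine Fintype.sum_bijective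
    (fun (φ : ∀ i, A i) (i : {i // i < s i}) => (φ i, φ (s i))) ⟨?_, ?_⟩ _ _ (fun _ => rfl)
  · intro φ χ h
    have h' : ∀ i, i < s i → φ i = χ i ∧ φ (s i) = χ (s i) := fun i hi => by
      simpa using congrFun h ⟨i, hi⟩
    funext i
    by_cases hi : i < s i
    · exact (h' i hi).1
    · have := (h' (s i) ((hs.lt_iff i).2 hi)).2
      rwa [(hs i).2] at this
  · intro ψ
    -- The entry at an upper index is read off from the pair of its partner; its type is `A (s (s
    -- i))`, equal to `A i` only propositionally, hence the cast.
    have hcast : ∀ i, A (s (s i)) = A i := fun i => by rw [(hs i).2]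
    refine ⟨fun i => if h : i < s i then (ψ ⟨i, h⟩).1
      else cast (hcast i) (ψ ⟨s i, (hs.lt_iff i).2 h⟩).2, ?_⟩
    funext ⟨i, hi⟩
    have hsi : ¬ s i < s (s i) := by rw [hs.lt_iff]; exact not_not.2 hi
    have key : ∀ (k : Fin r) (hk : k = i) (h : k < s k) (e : A (s k) = A (s i)),
        cast e (ψ ⟨k, h⟩).2 = (ψ ⟨i, hi⟩).2 := by
      rintro k rfl h e
      rfl
    ext1
    · simp [hi]
    · simp only [hsi, dite_false]
      exact key _ (hs i).2 _ _

/-- Pairings of `2n` points are the permutations of cycle type `2^n`, so the size of a conjugacy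
class counts them. This number is the `2n`-th moment of a standard Gaussian. -/
lemma card_isPairing (n : ℕ) [DecidablePred (IsPairing (r := 2 * n))] :
    ((Finset.univ.filter (IsPairing (r := 2 * n))).card : ℝ)
      = (2 * n).factorial / (2 ^ n * n.factorial) := by
  classical
  have h : Finset.univ.filter (IsPairing (r := 2 * n))
      = Finset.univ.filter (fun g : Equiv.Perm (Fin (2 * n)) =>
          g.cycleType = Multiset.replicate n 2) := by
    ext s
    simp only [Finset.mem_filter, Finset.mem_univ, true_and]
    constructor
    · intro hs
      have hsq : s ^ 2 = 1 := by
        ext i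
        simp [pow_two, (hs i).2]
      have h2 : ∀ k ∈ s.cycleType, k = 2 := by
        intro k hk
        have hd : k ∣ 2 := (Equiv.Perm.dvd_of_mem_cycleType hk).trans (orderOf_dvd_of_pow_eq_one hsq)
        have := Equiv.Perm.two_le_of_mem_cycleType hk
        exact le_antisymm (Nat.le_of_dvd (by norm_num) hd) this
      have hrep := Multiset.eq_replicate_of_mem h2
      have hsupp : s.support = Finset.univ := by
        ext i
        simp [(hs i).1]
      have hsum := s.sum_cycleType
      rw [hsupp, Finset.card_univ, Fintype.card_fin, hrep, Multiset.sum_replicate, smul_eq_mul,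
        mul_comm] at hsum
      rw [hrep, Nat.eq_of_mul_eq_mul_left (by norm_num) hsum]
    · intro hs
      have hsum := s.sum_cycleType
      rw [hs, Multiset.sum_replicate, smul_eq_mul, mul_comm] at hsum
      have hsupp : s.support = Finset.univ := by
        rw [← Finset.card_eq_iff_eq_univ, ← hsum, Fintype.card_fin]
      have hsq : s ^ 2 = 1 := by
        rw [← orderOf_dvd_iff_pow_eq_one, ← Equiv.Perm.lcm_cycleType, hs, Multiset.lcm_dvd]
        intro k hk
        rw [Multiset.eq_of_mem_replicate hk]
      intro i
      constructor
      · have : i ∈ s.support := by rw [hsupp]; exact Finset.mem_univ _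
        simpa using this
      · have := congrArg (fun t : Equiv.Perm (Fin (2 * n)) => t i) hsq
        simpa [pow_two] using this
  have hmul := Equiv.Perm.card_of_cycleType_mul_eq (Fin (2 * n)) (Multiset.replicate n 2)
  have hden : (Fintype.card (Fin (2 * n)) - (Multiset.replicate n 2).sum).factorial *
      (Multiset.replicate n 2).prod *
      ∏ k ∈ (Multiset.replicate n 2).toFinset, ((Multiset.replicate n 2).count k).factorial
      = 2 ^ n * n.factorial := by
    rw [Multiset.sum_replicate, Multiset.prod_replicate, smul_eq_mul, Fintype.card_fin, mul_comm n,
      Nat.sub_self, Nat.factorial_zero, one_mul]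
    rcases Nat.eq_zero_or_pos n with rfl | hn
    · simp
    · rw [Multiset.toFinset_replicate, if_neg hn.ne', Finset.prod_singleton,
        Multiset.count_replicate_self]
  rw [hden, if_pos, Fintype.card_fin] at hmul
  · rw [h, eq_div_iff (by positivity)]
    exact_mod_cast hmul
  · rw [Multiset.sum_replicate, smul_eq_mul, Fintype.card_fin, mul_comm]
    exact ⟨le_rfl, fun a ha => (Multiset.eq_of_mem_replicate ha).ge⟩

/-! ### Counting vertices against edges -/

/-- A map choosing a representative in every connected component of the graph with edge set `P`;
there are at least `|α| - |P|` components. -/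
lemma exists_component_rep {α : Type} [Fintype α] [DecidableEq α] (P : Finset (Sym2 α)) :
    ∃ rep : α → α, (∀ a b, s(a, b) ∈ P → rep a = rep b) ∧
      Fintype.card α ≤ P.card + (Finset.univ.image rep).card := by
  induction P using Finset.induction_on with
  | empty => exact ⟨id, by simp, by simp⟩
  | insert p P hp ih =>
    obtain ⟨rep, h1, h2⟩ := ih
    induction p using Sym2.ind with
    | _ a b =>
      rw [Finset.card_insert_of_notMem hp]
      refine ⟨fun x => if rep x = rep b then rep a else rep x, ?_, ?_⟩
      · intro x y hxy
        rw [Finset.mem_insert] at hxy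
        rcases hxy with h | h
        · rw [Sym2.eq_iff] at h
          rcases h with ⟨rfl, rfl⟩ | ⟨rfl, rfl⟩ <;> simp
        · simp only [h1 x y h]
      · have : (Finset.univ.image rep).erase (rep b) ⊆
            Finset.univ.image (fun x => if rep x = rep b then rep a else rep x) := by
          intro y hy
          simp only [Finset.mem_erase, Finset.mem_image, Finset.mem_univ, true_and] at hy ⊢
          obtain ⟨hne, x, rfl⟩ := hy
          exact ⟨x, by simp [hne]⟩
        have h3 := Finset.card_le_card this
        have h4 := Finset.pred_card_le_card_erase (s := Finset.univ.image rep) (a := rep b)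
        omega

/-- If the vertex set `U` is covered by parts `j : J` on each of which the graph `P` is connected,
and every part shares a vertex with another part, then `2 |U| ≤ 2 |P| + |J|`; equality forces
the relation of sharing a vertex to be a perfect matching. -/
lemma two_mul_card_le_of_parts {α J : Type} [Fintype α] [DecidableEq α] [Fintype J] [DecidableEq J]
    (P : Finset (Sym2 α)) (U : J → Finset α) (hne : ∀ j, (U j).Nonempty)
    (hconn : ∀ j (h : α → α), (∀ a b, s(a, b) ∈ P → h a = h b) →
      ∀ a ∈ U j, ∀ b ∈ U j, h a = h b)
    (hshare : ∀ j, ∃ j', j' ≠ j ∧ (U j ∩ U j').Nonempty) :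
    2 * (Finset.univ.biUnion U).card + 1 ≤ 2 * P.card + Fintype.card J ∨
      ∀ j j' j'', (U j ∩ U j').Nonempty → (U j ∩ U j'').Nonempty → j' ≠ j → j'' ≠ j → j' = j'' := by
  obtain ⟨rep, h1, h2⟩ := exists_component_rep P
  choose x hx using hne
  let f : J → α := fun j => rep (x j)
  have hf : ∀ j, ∀ a ∈ U j, rep a = f j := fun j a ha => hconn j rep h1 a ha _ (hx j)
  have hfs : ∀ j j', (U j ∩ U j').Nonempty → f j = f j' := by
    rintro j j' ⟨a, ha⟩
    rw [Finset.mem_inter] at ha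
    rw [← hf j a ha.1, hf j' a ha.2]
  -- Every component either contains a part or consists of vertices outside all parts, and there are
  -- at most `|Uᶜ|` of the latter kind.
  have himg : Finset.univ.image rep ⊆
      Finset.univ.image f ∪ (Finset.univ.biUnion U)ᶜ.image rep := by
    intro y hy
    rw [Finset.mem_image] at hy
    obtain ⟨a, _, rfl⟩ := hy
    rw [Finset.mem_union]
    by_cases ha : a ∈ Finset.univ.biUnion U
    · left
      rw [Finset.mem_biUnion] at ha
      obtain ⟨j, _, hj⟩ := ha
      rw [hf j a hj]
      exact Finset.mem_image_of_mem _ (Finset.mem_univ _)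
    · right
      exact Finset.mem_image_of_mem _ (Finset.mem_compl.2 ha)
  have hcard : (Finset.univ.biUnion U).card ≤ P.card + (Finset.univ.image f).card := by
    have h3 := (Finset.card_le_card himg).trans (Finset.card_union_le _ _)
    have h4 := Finset.card_image_le (s := (Finset.univ.biUnion U)ᶜ) (f := rep)
    have h5 := Finset.card_add_card_compl (Finset.univ.biUnion U)
    omega
  -- A part and one it meets lie in the same component, so each component holds at least two parts;
  -- three in one of them would make the inequality strict.
  have hfib : ∀ y ∈ Finset.univ.image f, 2 ≤ (Finset.univ.filter fun j => f j = y).card := by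
    intro y hy
    rw [Finset.mem_image] at hy
    obtain ⟨j, _, rfl⟩ := hy
    obtain ⟨j', hj', hs⟩ := hshare j
    have : ({j, j'} : Finset J) ⊆ Finset.univ.filter fun i => f i = f j := by
      intro i hi
      simp only [Finset.mem_insert, Finset.mem_singleton] at hi
      rcases hi with rfl | rfl
      · simp
      · simp [hfs j _ hs]
    rw [← Finset.card_pair hj'.symm]
    exact Finset.card_le_card this
  have hsum : Fintype.card J = ∑ y ∈ Finset.univ.image f,
      (Finset.univ.filter fun j => f j = y).card := by
    rw [← Finset.card_univ]
    exact Finset.card_eq_sum_card_image f Finset.univ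
  by_contra! hcon
  obtain ⟨hlt, j, j', j'', hj', hj'', hne', hne'', hne3⟩ := hcon
  have hlt' : ∑ y ∈ Finset.univ.image f, 2 < ∑ y ∈ Finset.univ.image f,
      (Finset.univ.filter fun j => f j = y).card := by
    refine Finset.sum_lt_sum hfib ⟨f j, Finset.mem_image_of_mem _ (Finset.mem_univ _), ?_⟩
    have : ({j, j', j''} : Finset J) ⊆ Finset.univ.filter fun i => f i = f j := by
      intro i hi
      simp only [Finset.mem_insert, Finset.mem_singleton] at hi
      rcases hi with rfl | rfl | rfl
      · simp
      · simp [hfs j _ hj']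
      · simp [hfs j _ hj'']
    have h3 : ({j, j', j''} : Finset J).card = 3 := by
      rw [Finset.card_eq_three]
      exact ⟨j, j', j'', hne'.symm, hne''.symm, hne3, rfl⟩
    have := Finset.card_le_card this
    omega
  rw [← hsum, Finset.sum_const, smul_eq_mul] at hlt'
  omega


/-! ### Random variables with moments of all orders -/

/-- `f` has finite moments of all orders. -/
def HasAllMoments {Ω : Type*} [MeasurableSpace Ω] (P : Measure Ω) (f : Ω → ℝ) : Prop :=
  ∀ k : ℕ, MemLp f k P

namespace HasAllMoments

variable {Ω : Type*} [MeasurableSpace Ω] {P : Measure Ω} [IsProbabilityMeasure P] {f g : Ω → ℝ}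

lemma integrable (hf : HasAllMoments P f) : Integrable f P := by
  rw [← memLp_one_iff_integrable]
  exact_mod_cast hf 1

lemma of_integrable_pow (hf : Measurable f) (h : ∀ k : ℕ, Integrable (fun ω => f ω ^ k) P) :
    HasAllMoments P f := by
  intro k
  -- An even exponent makes `|f|^p` equal to `f^p`; the shift by one keeps it nonzero, as the norm
  -- criterion requires.
  have h2 : MemLp f ((2 * (k + 1) : ℕ) : ENNReal) P := by
    rw [← integrable_norm_rpow_iff hf.aestronglyMeasurable (by simp)
      (ENNReal.natCast_ne_top _)]
    refine (h (2 * (k + 1))).congr (Eventually.of_forall fun ω => ?_)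
    simp only [ENNReal.toReal_natCast, Real.rpow_natCast, Real.norm_eq_abs]
    rw [pow_mul, pow_mul, sq_abs]
  exact h2.mono_exponent (by exact_mod_cast (by omega : k ≤ 2 * (k + 1)))

lemma const (c : ℝ) : HasAllMoments P (fun _ => c) := fun _ => memLp_const c

lemma sub (hf : HasAllMoments P f) (hg : HasAllMoments P g) :
    HasAllMoments P (fun ω => f ω - g ω) := fun k => (hf k).sub (hg k)

lemma mul (hf : HasAllMoments P f) (hg : HasAllMoments P g) :
    HasAllMoments P (fun ω => f ω * g ω) := by
  intro k
  have : ENNReal.HolderTriple ((2 * k : ℕ) : ENNReal) ((2 * k : ℕ) : ENNReal) (k : ENNReal) := by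
    constructor
    push_cast
    rw [ENNReal.mul_inv (by simp) (by simp), ← add_mul, ENNReal.inv_two_add_inv_two, one_mul]
  exact (hg (2 * k)).mul (hf (2 * k))

lemma const_mul (c : ℝ) (hf : HasAllMoments P f) : HasAllMoments P (fun ω => c * f ω) :=
  (const c).mul hf

lemma sum {ι : Type*} (s : Finset ι) {f : ι → Ω → ℝ} (hf : ∀ i ∈ s, HasAllMoments P (f i)) :
    HasAllMoments P (fun ω => ∑ i ∈ s, f i ω) := fun k =>
  memLp_finsetSum s fun i hi => hf i hi k

lemma prod {ι : Type*} (s : Finset ι) {f : ι → Ω → ℝ} (hf : ∀ i ∈ s, HasAllMoments P (f i)) :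
    HasAllMoments P (fun ω => ∏ i ∈ s, f i ω) := by
  classical
  induction s using Finset.induction_on with
  | empty => simpa using const 1
  | insert i s hi ih =>
    simp_rw [Finset.prod_insert hi]
    exact (hf i (Finset.mem_insert_self i s)).mul
      (ih fun j hj => hf j (Finset.mem_insert_of_mem hj))

end HasAllMoments

/-! ### Functions of finitely many members of an independent family -/

/-- `f` is a measurable function of the `Y i`, `i ∈ S`. -/
def IsFunctionOf {Ω ι β : Type*} [MeasurableSpace β] (Y : ι → Ω → β) (S : Finset ι)
    (f : Ω → ℝ) : Prop :=
  ∃ g : (S → β) → ℝ, Measurable g ∧ ∀ ω, f ω = g (fun i => Y i ω)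

namespace IsFunctionOf

variable {Ω ι β : Type*} [MeasurableSpace β] {Y : ι → Ω → β}
  {S T : Finset ι} {f h : Ω → ℝ}

lemma mono (hf : IsFunctionOf Y S f) (hST : S ⊆ T) : IsFunctionOf Y T f := by
  obtain ⟨g, hg, hfg⟩ := hf
  refine ⟨fun x => g (fun i => x ⟨i, hST i.2⟩), hg.comp ?_, hfg⟩
  exact measurable_pi_lambda _ fun i => measurable_pi_apply _

lemma const (c : ℝ) : IsFunctionOf Y S (fun _ => c) := ⟨fun _ => c, measurable_const, fun _ => rfl⟩

lemma mul (hf : IsFunctionOf Y S f) (hh : IsFunctionOf Y S h) :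
    IsFunctionOf Y S (fun ω => f ω * h ω) := by
  obtain ⟨g, hg, hfg⟩ := hf
  obtain ⟨g', hg', hfg'⟩ := hh
  exact ⟨fun x => g x * g' x, hg.mul hg', fun ω => by simp only [hfg, hfg']⟩

lemma sub (hf : IsFunctionOf Y S f) (hh : IsFunctionOf Y S h) :
    IsFunctionOf Y S (fun ω => f ω - h ω) := by
  obtain ⟨g, hg, hfg⟩ := hf
  obtain ⟨g', hg', hfg'⟩ := hh
  exact ⟨fun x => g x - g' x, hg.sub hg', fun ω => by simp only [hfg, hfg']⟩

lemma prod {κ : Type*} (B : Finset κ) {f : κ → Ω → ℝ} (hf : ∀ i ∈ B, IsFunctionOf Y S (f i)) :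
    IsFunctionOf Y S (fun ω => ∏ i ∈ B, f i ω) := by
  classical
  induction B using Finset.induction_on with
  | empty => simpa using const 1
  | insert i B hi ih =>
    simp_rw [Finset.prod_insert hi]
    exact (hf i (Finset.mem_insert_self i B)).mul
      (ih fun j hj => hf j (Finset.mem_insert_of_mem hj))

lemma integral_mul [MeasurableSpace Ω] {P : Measure Ω} (hY : iIndepFun Y P) (hm : ∀ i, Measurable (Y i))
    (hST : Disjoint S T) (hf : IsFunctionOf Y S f) (hh : IsFunctionOf Y T h) :
    ∫ ω, f ω * h ω ∂P = (∫ ω, f ω ∂P) * ∫ ω, h ω ∂P := by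
  obtain ⟨g, hg, hfg⟩ := hf
  obtain ⟨g', hg', hfg'⟩ := hh
  have hind := hY.indepFun_finset S T hST hm
  simp_rw [hfg, hfg']
  exact hind.integral_fun_comp_mul_comp
    (measurable_pi_lambda _ fun i : S => hm i).aemeasurable
    (measurable_pi_lambda _ fun i : T => hm i).aemeasurable
    hg.aestronglyMeasurable hg'.aestronglyMeasurable

lemma integral_prod [MeasurableSpace Ω] [DecidableEq ι] {P : Measure Ω} (hY : iIndepFun Y P)
    (hm : ∀ i, Measurable (Y i)) {κ : Type*} (B : Finset κ) {f : κ → Ω → ℝ} {S : κ → Finset ι}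
    (hS : ∀ i ∈ B, ∀ j ∈ B, i ≠ j → Disjoint (S i) (S j))
    (hf : ∀ i ∈ B, IsFunctionOf Y (S i) (f i)) :
    ∫ ω, ∏ i ∈ B, f i ω ∂P = ∏ i ∈ B, ∫ ω, f i ω ∂P := by
  classical
  have := hY.isProbabilityMeasure
  induction B using Finset.induction_on with
  | empty => simp
  | insert i B hi ih =>
    simp_rw [Finset.prod_insert hi]
    rw [← ih (fun a ha b hb => hS a (Finset.mem_insert_of_mem ha) b (Finset.mem_insert_of_mem hb))
      (fun j hj => hf j (Finset.mem_insert_of_mem hj))]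
    refine integral_mul hY hm (S := S i) (T := B.biUnion S) ?_ (hf i (Finset.mem_insert_self i B))
      (prod B fun j hj => (hf j (Finset.mem_insert_of_mem hj)).mono
        (Finset.subset_biUnion_of_mem S hj))
    rw [Finset.disjoint_biUnion_right]
    intro j hj
    exact hS i (Finset.mem_insert_self i B) j (Finset.mem_insert_of_mem hj)
      (fun h => hi (h ▸ hj))

end IsFunctionOf

/-! ### Monomials in the entries of an elliptic matrix -/

/-- The unordered pair underlying an ordered pair. -/
abbrev unordered {α : Type*} (x : α × α) : Sym2 α := s(x.1, x.2)

/-- A random matrix with centered entries of finite moments, whose entries are independent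
up to the dependence of the `(i, j)` entry on the `(j, i)` entry. -/
structure IsEllipticMatrix {Ω : Type*} [MeasurableSpace Ω] {N : ℕ} (P : Measure Ω)
    (A : Ω → Matrix (Fin N) (Fin N) ℝ) : Prop where
  measurable : ∀ i j, Measurable fun ω => A ω i j
  moments : ∀ i j, HasAllMoments P fun ω => A ω i j
  mean : ∀ i j, ∫ ω, A ω i j ∂P = 0
  indep : iIndepFun
    (fun (p : {p : Fin N × Fin N // p.1 ≤ p.2}) ω => (A ω p.1.1 p.1.2, A ω p.1.2 p.1.1)) P

/-- The pair of entries of `A` at an unordered pair of indices, smaller row index first. -/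
def pairEntries {Ω : Type*} {N : ℕ} (A : Ω → Matrix (Fin N) (Fin N) ℝ) (p : Sym2 (Fin N))
    (ω : Ω) : ℝ × ℝ :=
  (A ω (Sym2.sortEquiv p).1.1 (Sym2.sortEquiv p).1.2, A ω (Sym2.sortEquiv p).1.2 (Sym2.sortEquiv p).1.1)

/-- The product of the entries of `M` at the positions `γ e`, `e ∈ S`. -/
def monomial {𝓔 : Type*} {N : ℕ} (M : Matrix (Fin N) (Fin N) ℝ) (γ : 𝓔 → Fin N × Fin N)
    (S : Finset 𝓔) : ℝ := ∏ e ∈ S, M (γ e).1 (γ e).2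

/-- The set of unordered pairs of positions occurring in a monomial. -/
def pairs {𝓔 α : Type*} [DecidableEq α] (γ : 𝓔 → α × α) (S : Finset 𝓔) : Finset (Sym2 α) :=
  S.image fun e => unordered (γ e)

namespace IsEllipticMatrix

variable {Ω : Type*} [MeasurableSpace Ω] {N : ℕ} {P : Measure Ω} [IsProbabilityMeasure P]
  {A : Ω → Matrix (Fin N) (Fin N) ℝ} {𝓔 : Type*}

lemma measurable_pairEntries (hA : IsEllipticMatrix P A) (p : Sym2 (Fin N)) :
    Measurable (pairEntries A p) := (hA.measurable _ _).prodMk (hA.measurable _ _)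

/-- Indexing the independent family by unordered pairs lets the set of pairs occupied by a monomial
serve as the set of variables it depends on. -/
lemma iIndepFun_pairEntries (hA : IsEllipticMatrix P A) : iIndepFun (pairEntries A) P :=
  hA.indep.precomp (g := Sym2.sortEquiv) Sym2.sortEquiv.injective

lemma isFunctionOf_entry (i j : Fin N) :
    IsFunctionOf (pairEntries A) {s(i, j)} (fun ω => A ω i j) := by
  rcases le_total i j with h | h
  · refine ⟨fun x => (x ⟨s(i, j), Finset.mem_singleton_self _⟩).1, ?_, fun ω => ?_⟩
    · exact measurable_fst.comp (measurable_pi_apply _)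
    · simp [pairEntries, Sym2.sortEquiv, h]
  · refine ⟨fun x => (x ⟨s(i, j), Finset.mem_singleton_self _⟩).2, ?_, fun ω => ?_⟩
    · exact measurable_snd.comp (measurable_pi_apply _)
    · simp [pairEntries, Sym2.sortEquiv, h]

lemma isFunctionOf_monomial (γ : 𝓔 → Fin N × Fin N) (S : Finset 𝓔) :
    IsFunctionOf (pairEntries A) (pairs γ S) (fun ω => monomial (A ω) γ S) := by
  refine IsFunctionOf.prod S fun e he => (isFunctionOf_entry _ _).mono ?_
  rw [Finset.singleton_subset_iff]
  exact Finset.mem_image_of_mem (fun e => unordered (γ e)) he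

lemma hasAllMoments_monomial (hA : IsEllipticMatrix P A) (γ : 𝓔 → Fin N × Fin N)
    (S : Finset 𝓔) : HasAllMoments P (fun ω => monomial (A ω) γ S) :=
  HasAllMoments.prod S fun _ _ => hA.moments _ _

/-- The expectation of a monomial factorizes over the unordered pairs of positions. -/
lemma integral_monomial (hA : IsEllipticMatrix P A) (γ : 𝓔 → Fin N × Fin N) (S : Finset 𝓔) :
    ∫ ω, monomial (A ω) γ S ∂P =
      ∏ p ∈ pairs γ S, ∫ ω, monomial (A ω) γ (S.filter fun e => unordered (γ e) = p) ∂P := by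
  have h : ∀ ω, monomial (A ω) γ S =
      ∏ p ∈ pairs γ S, monomial (A ω) γ (S.filter fun e => unordered (γ e) = p) := by
    intro ω
    exact (Finset.prod_fiberwise_of_maps_to (fun e he => Finset.mem_image_of_mem _ he) _).symm
  simp_rw [h]
  refine IsFunctionOf.integral_prod hA.iIndepFun_pairEntries hA.measurable_pairEntries _
    (S := fun p => {p}) (fun p _ q _ hpq => by simpa using hpq)
    (fun p _ => (isFunctionOf_monomial γ _).mono ?_)
  intro q hq
  rw [pairs, Finset.mem_image] at hq
  obtain ⟨e, he, rfl⟩ := hq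
  rw [Finset.mem_singleton]
  exact (Finset.mem_filter.1 he).2

end IsEllipticMatrix

/-- A monomial supported on one unordered pair of positions. -/
lemma monomial_of_forall_eq {𝓔 : Type*} [DecidableEq 𝓔] {N : ℕ} (M : Matrix (Fin N) (Fin N) ℝ)
    (γ : 𝓔 → Fin N × Fin N) (S : Finset 𝓔) (i j : Fin N)
    (hS : ∀ e ∈ S, unordered (γ e) = s(i, j)) :
    monomial M γ S = M i j ^ (S.filter fun e => γ e = (i, j)).card *
      M j i ^ (S.filter fun e => ¬ γ e = (i, j)).card := by
  rw [monomial, ← Finset.prod_filter_mul_prod_filter_not S (fun e => γ e = (i, j))]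
  congr 1
  · refine Finset.prod_eq_pow_card fun e he => ?_
    rw [(Finset.mem_filter.1 he).2]
  · refine Finset.prod_eq_pow_card fun e he => ?_
    obtain ⟨he, hne⟩ := Finset.mem_filter.1 he
    have := hS e he
    rw [Sym2.eq_iff] at this
    rcases this with h | h
    · exact absurd (Prod.ext h.1 h.2) hne
    · rw [h.1, h.2]

/-- The limiting behaviour of the moments of a sequence of elliptic matrices. -/
structure HasMomentLimits {Ω : ℕ → Type*} [∀ N, MeasurableSpace (Ω N)]
    (P : ∀ N, Measure (Ω N)) (A : ∀ N, Ω N → Matrix (Fin N) (Fin N) ℝ) (C : ℕ → ℕ → ℝ) :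
    Prop where
  elliptic : ∀ N, IsEllipticMatrix (P N) (A N)
  offDiag : ∀ k l : ℕ, 2 ≤ k + l →
    Tendsto (fun x : Σ N, {p : Fin N × Fin N // p.1 < p.2} =>
      (x.1 : ℝ) * ∫ ω, A x.1 ω x.2.1.1 x.2.1.2 ^ k * A x.1 ω x.2.1.2 x.2.1.1 ^ l ∂(P x.1))
      (comap Sigma.fst atTop) (𝓝 (C k l))
  diag : ∀ k : ℕ, 1 ≤ k → ∃ K : ℝ, ∀ᶠ N in atTop, ∀ i : Fin N,
    |(N : ℝ) * ∫ ω, A N ω i i ^ k ∂(P N)| ≤ K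

/-- Convergence along `comap Sigma.fst atTop` encodes uniformity in the second component, here an
entry position or a labelling. -/
lemma eventually_comap_fst {B : ℕ → Type*} {p : (Σ N, B N) → Prop} :
    (∀ᶠ x in comap (Sigma.fst : (Σ N, B N) → ℕ) atTop, p x) ↔
      ∀ᶠ N in atTop, ∀ b : B N, p ⟨N, b⟩ := by
  rw [eventually_comap]
  constructor
  · intro h
    filter_upwards [h] with N hN b
    exact hN ⟨N, b⟩ rfl
  · intro h
    filter_upwards [h] with N hN
    rintro ⟨M, b⟩ rfl
    exact hN b

namespace HasMomentLimits

variable {Ω : ℕ → Type*} [∀ N, MeasurableSpace (Ω N)] {P : ∀ N, Measure (Ω N)}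
  [∀ N, IsProbabilityMeasure (P N)] {A : ∀ N, Ω N → Matrix (Fin N) (Fin N) ℝ} {C : ℕ → ℕ → ℝ}

lemma exists_local_bound_of_pos (hA : HasMomentLimits P A C) (k l : ℕ) (hkl : 1 ≤ k + l) :
    ∃ K : ℝ, ∀ᶠ N in atTop, ∀ i j : Fin N, i ≤ j →
      |(N : ℝ) * ∫ ω, A N ω i j ^ k * A N ω j i ^ l ∂(P N)| ≤ K := by
  obtain ⟨K₁, hK₁⟩ := hA.diag (k + l) hkl
  have hoff : ∃ K : ℝ, ∀ᶠ N in atTop, ∀ i j : Fin N, i < j →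
      |(N : ℝ) * ∫ ω, A N ω i j ^ k * A N ω j i ^ l ∂(P N)| ≤ K := by
    rcases hkl.eq_or_lt with h | h
    -- Total degree one is not covered by the moment asymptotics; there the entries being centered
    -- gives 0.
    · refine ⟨0, Eventually.of_forall fun N i j _ => ?_⟩
      have : (k = 1 ∧ l = 0) ∨ (k = 0 ∧ l = 1) := by omega
      rcases this with ⟨rfl, rfl⟩ | ⟨rfl, rfl⟩ <;> simp [(hA.elliptic N).mean]
    · refine ⟨|C k l| + 1, ?_⟩
      have := (hA.offDiag k l h).abs.eventually_le_const (u := |C k l| + 1) (by linarith)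
      rw [eventually_comap_fst] at this
      filter_upwards [this] with N hN i j hij
      exact hN ⟨(i, j), hij⟩
  obtain ⟨K₂, hK₂⟩ := hoff
  refine ⟨max K₁ K₂, ?_⟩
  filter_upwards [hK₁, hK₂] with N h1 h2 i j hij
  rcases hij.eq_or_lt with rfl | hlt
  · simp_rw [← pow_add]
    exact (h1 i).trans (le_max_left _ _)
  · exact (h2 i j hlt).trans (le_max_right _ _)

lemma exists_local_bound (hA : HasMomentLimits P A C) (c : ℕ) :
    ∃ K : ℝ, 1 ≤ K ∧ ∀ᶠ N in atTop, ∀ i j : Fin N, i ≤ j → ∀ k ≤ c, ∀ l ≤ c, 1 ≤ k + l →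
      |(N : ℝ) * ∫ ω, A N ω i j ^ k * A N ω j i ^ l ∂(P N)| ≤ K := by
  have h : ∀ x : ℕ × ℕ, ∃ K : ℝ, 1 ≤ x.1 + x.2 → ∀ᶠ N in atTop, ∀ i j : Fin N, i ≤ j →
      |(N : ℝ) * ∫ ω, A N ω i j ^ x.1 * A N ω j i ^ x.2 ∂(P N)| ≤ K := by
    intro x
    by_cases hx : 1 ≤ x.1 + x.2
    · obtain ⟨K, hK⟩ := hA.exists_local_bound_of_pos _ _ hx
      exact ⟨K, fun _ => hK⟩
    · exact ⟨0, fun h => absurd h hx⟩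
  choose K hK using h
  let I := Finset.range (c + 1) ×ˢ Finset.range (c + 1)
  refine ⟨1 + ∑ x ∈ I, |K x|, le_add_of_nonneg_right (Finset.sum_nonneg fun _ _ => abs_nonneg _), ?_⟩
  have hall : ∀ᶠ N in atTop, ∀ x ∈ I, 1 ≤ x.1 + x.2 → ∀ i j : Fin N, i ≤ j →
      |(N : ℝ) * ∫ ω, A N ω i j ^ x.1 * A N ω j i ^ x.2 ∂(P N)| ≤ K x := by
    rw [Finset.eventually_all]
    intro x _
    by_cases hx : 1 ≤ x.1 + x.2
    · filter_upwards [hK x hx] with N hN _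
      exact hN
    · exact Eventually.of_forall fun N h => absurd h hx
  filter_upwards [hall] with N hN i j hij k hk l hl hkl
  have hmem : (k, l) ∈ I := by simp only [I, Finset.mem_product, Finset.mem_range]; omega
  have := Finset.single_le_sum (fun x _ => abs_nonneg (K x)) hmem
  linarith [hN (k, l) hmem hkl i j hij, le_abs_self (K (k, l))]

/-- The factor of a monomial at one unordered pair of positions is `O(1/N)`. -/
lemma exists_pair_bound (hA : HasMomentLimits P A C) (𝓔 : Type*) [Fintype 𝓔] :
    ∃ K : ℝ, 1 ≤ K ∧ ∀ᶠ N in atTop, ∀ (γ : 𝓔 → Fin N × Fin N) (S : Finset 𝓔), ∀ p ∈ pairs γ S,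
      |(N : ℝ) * ∫ ω, monomial (A N ω) γ (S.filter fun e => unordered (γ e) = p) ∂(P N)| ≤ K := by
  classical
  obtain ⟨K, hK1, hK⟩ := hA.exists_local_bound (Fintype.card 𝓔)
  refine ⟨K, hK1, ?_⟩
  filter_upwards [hK] with N hN γ S p hp
  have hne : (S.filter fun e => unordered (γ e) = p).Nonempty := by
    rw [pairs, Finset.mem_image] at hp
    obtain ⟨e, he, h⟩ := hp
    exact ⟨e, Finset.mem_filter.2 ⟨he, h⟩⟩
  -- The local bounds are stated for `i ≤ j`, so the unordered pair is written in increasing order.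
  have hex : ∃ i j, i ≤ j ∧ p = s(i, j) := by
    induction p using Sym2.ind with
    | _ a b =>
      rcases le_total a b with h | h
      · exact ⟨a, b, h, rfl⟩
      · exact ⟨b, a, h, Sym2.eq_swap⟩
  obtain ⟨i, j, hij, rfl⟩ := hex
  set B := S.filter fun e => unordered (γ e) = s(i, j) with hB
  simp_rw [monomial_of_forall_eq _ γ B i j (fun e he => (Finset.mem_filter.1 he).2)]
  refine hN i j hij _ (Finset.card_le_univ _) _ (Finset.card_le_univ _) ?_
  rw [Finset.card_filter_add_card_filter_not]
  exact hne.card_pos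

/-- The expectation of a monomial is `O(N ^ (-#pairs))`. -/
lemma exists_monomial_bound (hA : HasMomentLimits P A C) (𝓔 : Type*) [Fintype 𝓔] :
    ∃ K : ℝ, 1 ≤ K ∧ ∀ᶠ N in atTop, ∀ (γ : 𝓔 → Fin N × Fin N) (S : Finset 𝓔),
      |∫ ω, monomial (A N ω) γ S ∂(P N)| ≤ K * ((N : ℝ) ^ (pairs γ S).card)⁻¹ := by
  obtain ⟨K, hK1, hK⟩ := hA.exists_pair_bound 𝓔
  refine ⟨K ^ Fintype.card 𝓔, one_le_pow₀ hK1, ?_⟩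
  filter_upwards [hK, eventually_gt_atTop 0] with N hN hpos γ S
  have hN0 : (0 : ℝ) < N := by exact_mod_cast hpos
  rw [(hA.elliptic N).integral_monomial, Finset.abs_prod, ← inv_pow]
  calc ∏ p ∈ pairs γ S, |∫ ω, monomial (A N ω) γ (S.filter fun e => unordered (γ e) = p) ∂(P N)|
      ≤ ∏ _p ∈ pairs γ S, K * (N : ℝ)⁻¹ := by
        refine Finset.prod_le_prod (fun _ _ => abs_nonneg _) fun p hp => ?_
        have := hN γ S p hp
        rw [abs_mul, abs_of_pos hN0] at this
        rwa [← div_eq_mul_inv, le_div_iff₀' hN0]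
    _ = K ^ (pairs γ S).card * (N : ℝ)⁻¹ ^ (pairs γ S).card := by
        rw [Finset.prod_const, mul_pow]
    _ ≤ K ^ Fintype.card 𝓔 * (N : ℝ)⁻¹ ^ (pairs γ S).card := by
        refine mul_le_mul_of_nonneg_right (pow_le_pow_right₀ hK1 ?_) (by positivity)
        exact Finset.card_image_le.trans (Finset.card_le_univ _)

end HasMomentLimits

/-! ### Centered monomials -/

/-- The centered monomial of the edges in part `j`. -/
noncomputable def centered {Ω 𝓔 J : Type*} [MeasurableSpace Ω] [Fintype 𝓔] [DecidableEq J] {N : ℕ}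
    (P : Measure Ω) (A : Ω → Matrix (Fin N) (Fin N) ℝ) (γ : 𝓔 → Fin N × Fin N) (part : 𝓔 → J)
    (j : J) (ω : Ω) : ℝ :=
  monomial (A ω) γ (Finset.univ.filter fun e => part e = j) -
    ∫ ω', monomial (A ω') γ (Finset.univ.filter fun e => part e = j) ∂P

section Centered

variable {Ω 𝓔 J : Type*} [MeasurableSpace Ω] [Fintype 𝓔] [DecidableEq J] {N : ℕ}
  {P : Measure Ω} [IsProbabilityMeasure P] {A : Ω → Matrix (Fin N) (Fin N) ℝ}

lemma prod_monomial_parts (M : Matrix (Fin N) (Fin N) ℝ) (γ : 𝓔 → Fin N × Fin N) (part : 𝓔 → J)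
    (B : Finset J) :
    ∏ j ∈ B, monomial M γ (Finset.univ.filter fun e => part e = j) =
      monomial M γ (Finset.univ.filter fun e => part e ∈ B) := by
  rw [monomial, ← Finset.prod_fiberwise_of_maps_to (t := B) (g := part)
    (fun e he => (Finset.mem_filter.1 he).2)]
  refine Finset.prod_congr rfl fun j hj => ?_
  rw [monomial, Finset.filter_filter]
  refine Finset.prod_congr ?_ fun _ _ => rfl
  ext e
  simp only [Finset.mem_filter, Finset.mem_univ, true_and]
  constructor
  · rintro rfl; exact ⟨hj, rfl⟩
  · exact fun h => h.2

end Centered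

/-- Mixed moments of centered monomials are `O(N ^ (-#pairs))`. -/
lemma HasMomentLimits.exists_centered_bound {Ω : ℕ → Type*} [∀ N, MeasurableSpace (Ω N)]
    {P : ∀ N, Measure (Ω N)} [∀ N, IsProbabilityMeasure (P N)]
    {A : ∀ N, Ω N → Matrix (Fin N) (Fin N) ℝ} {C : ℕ → ℕ → ℝ} (hA : HasMomentLimits P A C)
    (𝓔 J : Type*) [Fintype 𝓔] [Fintype J] [DecidableEq J] (part : 𝓔 → J) :
    ∃ K : ℝ, 1 ≤ K ∧ ∀ᶠ N in atTop, ∀ (γ : 𝓔 → Fin N × Fin N) (B : Finset J),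
      |∫ ω, ∏ j ∈ B, centered (P N) (A N) γ part j ω ∂(P N)| ≤
        K * ((N : ℝ) ^ (pairs γ (Finset.univ.filter fun e => part e ∈ B)).card)⁻¹ := by
  classical
  obtain ⟨K, hK1, hK⟩ := hA.exists_monomial_bound 𝓔
  refine ⟨2 ^ Fintype.card J * K ^ (Fintype.card J + 1),
    one_le_mul_of_one_le_of_one_le (one_le_pow₀ one_le_two) (one_le_pow₀ hK1), ?_⟩
  filter_upwards [hK, eventually_gt_atTop 0] with N hN hpos γ B
  have hN1 : (1 : ℝ) ≤ N := by exact_mod_cast hpos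
  have hN0 : (0 : ℝ) < N := by linarith
  set Q : J → Finset (Sym2 (Fin N)) := fun j => pairs γ (Finset.univ.filter fun e => part e = j)
  set E : J → ℝ := fun j => ∫ ω, monomial (A N ω) γ (Finset.univ.filter fun e => part e = j) ∂(P N)
  -- Expansion over the set `t` of factors left random, the others being replaced by minus their
  -- mean.
  have hexp : ∀ ω, ∏ j ∈ B, centered (P N) (A N) γ part j ω = ∑ t ∈ B.powerset,
      monomial (A N ω) γ (Finset.univ.filter fun e => part e ∈ t) * ∏ j ∈ B \ t, -E j := by
    intro ω
    simp_rw [centered, sub_eq_add_neg]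
    rw [Finset.prod_add]
    refine Finset.sum_congr rfl fun t _ => ?_
    rw [prod_monomial_parts]
  simp_rw [hexp]
  rw [integral_finsetSum _ fun t _ =>
    (((hA.elliptic N).hasAllMoments_monomial γ _).integrable.mul_const _)]
  refine (Finset.abs_sum_le_sum_abs _ _).trans ?_
  have hterm : ∀ t ∈ B.powerset,
      |∫ ω, monomial (A N ω) γ (Finset.univ.filter fun e => part e ∈ t) *
        ∏ j ∈ B \ t, -E j ∂(P N)| ≤ K ^ (Fintype.card J + 1) *
        ((N : ℝ) ^ (pairs γ (Finset.univ.filter fun e => part e ∈ B)).card)⁻¹ := by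
    intro t ht
    rw [integral_mul_const, abs_mul, Finset.abs_prod]
    have h1 := hN γ (Finset.univ.filter fun e => part e ∈ t)
    have h2 : ∏ j ∈ B \ t, |(-E j)| ≤ ∏ j ∈ B \ t, K * ((N : ℝ) ^ (Q j).card)⁻¹ :=
      Finset.prod_le_prod (fun _ _ => abs_nonneg _) fun j _ => by
        rw [abs_neg]; exact hN γ _
    rw [Finset.prod_mul_distrib, Finset.prod_const, Finset.prod_inv_distrib,
      Finset.prod_pow_eq_pow_sum] at h2
    refine (mul_le_mul h1 h2 (Finset.prod_nonneg fun _ _ => abs_nonneg _) (by positivity)).trans ?_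
    rw [mul_mul_mul_comm, ← pow_succ', ← mul_inv, ← pow_add]
    refine mul_le_mul (pow_le_pow_right₀ hK1 ?_) ?_ (by positivity) (by positivity)
    · exact Nat.succ_le_succ (Finset.card_le_univ _)
    · refine inv_anti₀ (by positivity) (pow_le_pow_right₀ hN1 ?_)
      -- Splitting off the parts outside `t` can only count pairs repeatedly, so no term of the
      -- expansion is larger than the claimed order.
      have hsub : pairs γ (Finset.univ.filter fun e => part e ∈ B) ⊆
          pairs γ (Finset.univ.filter fun e => part e ∈ t) ∪ (B \ t).biUnion Q := by
        intro p hp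
        rw [pairs, Finset.mem_image] at hp
        obtain ⟨e, he, rfl⟩ := hp
        rw [Finset.mem_union]
        by_cases het : part e ∈ t
        · left
          exact Finset.mem_image_of_mem (fun e => unordered (γ e))
            (Finset.mem_filter.2 ⟨Finset.mem_univ _, het⟩)
        · right
          rw [Finset.mem_biUnion]
          exact ⟨part e, Finset.mem_sdiff.2 ⟨(Finset.mem_filter.1 he).2, het⟩,
            Finset.mem_image_of_mem (fun e => unordered (γ e))
              (Finset.mem_filter.2 ⟨Finset.mem_univ _, rfl⟩)⟩
      exact (Finset.card_le_card hsub).trans ((Finset.card_union_le _ _).trans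
        (Nat.add_le_add_left Finset.card_biUnion_le _))
  refine (Finset.sum_le_sum hterm).trans ?_
  rw [Finset.sum_const, nsmul_eq_mul, ← mul_assoc, Finset.card_powerset]
  push_cast
  refine mul_le_mul_of_nonneg_right (mul_le_mul_of_nonneg_right
    (pow_le_pow_right₀ one_le_two (Finset.card_le_univ _)) (by positivity)) (by positivity)


/-! ### Eulerian multigraphs and thick trees -/

namespace Multidigraph

/-- A connected multigraph with as many incoming as outgoing edges at every vertex. -/
structure IsEulerian (T : Multidigraph) : Prop where
  nonempty : Nonempty T.V
  balanced : ∀ h : T.V → ℤ, ∑ e, h (T.src e) = ∑ e, h (T.tgt e)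
  connected : ∀ (B : Type) (h : T.V → B), (∀ e, h (T.src e) = h (T.tgt e)) → ∀ u v, h u = h v
  src_surjective : Function.Surjective T.src

/-- The endpoints of an edge. -/
def ends (T : Multidigraph) (e : T.E) : T.V × T.V := (T.src e, T.tgt e)

/-- The positions in an `N × N` matrix of the edges of `T`, for a labelling `φ` of the vertices. -/
def positions (T : Multidigraph) {N : ℕ} (φ : T.V → Fin N) (e : T.E) : Fin N × Fin N :=
  (φ (T.src e), φ (T.tgt e))

variable {T : Multidigraph}

lemma IsEulerian.toSimple_connected (hT : T.IsEulerian) : T.toSimple.Connected := by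
  have := hT.nonempty
  refine SimpleGraph.Connected.mk fun u v => ?_
  rw [← SimpleGraph.ConnectedComponent.eq]
  refine hT.connected _ T.toSimple.connectedComponentMk (fun e => ?_) u v
  rw [SimpleGraph.ConnectedComponent.eq]
  by_cases h : T.src e = T.tgt e
  · rw [h]
  · exact SimpleGraph.Adj.reachable ⟨h, e, Or.inl ⟨rfl, rfl⟩⟩

lemma mult_eq_sum (u v : T.V) :
    (T.mult u v : ℤ) = ∑ e, if T.src e = u ∧ T.tgt e = v then 1 else 0 := by
  rw [mult, Fintype.card_subtype, Finset.sum_boole]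

lemma mult_pos {u v : T.V} {e : T.E} (h1 : T.src e = u) (h2 : T.tgt e = v) : 0 < T.mult u v :=
  Fintype.card_pos_iff.2 ⟨⟨e, h1, h2⟩⟩

lemma exists_of_mult_pos {u v : T.V} (h : 0 < T.mult u v) : ∃ e, T.src e = u ∧ T.tgt e = v := by
  obtain ⟨e, he⟩ := Fintype.card_pos_iff.1 h
  exact ⟨e, he⟩

lemma mult_le (u v : T.V) : T.mult u v ≤ Fintype.card T.E := Fintype.card_subtype_le _

/-- In an Eulerian thick tree, every edge of the tree is crossed equally often in both
directions. -/
lemma IsEulerian.mult_comm (hT : T.IsEulerian) (ht : T.IsThickTree) (u v : T.V) :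
    T.mult u v = T.mult v u := by
  classical
  by_cases huv : u = v
  · rw [huv]
  by_cases hadj : T.toSimple.Adj u v
  · have htree : T.toSimple.IsTree := by
      rw [SimpleGraph.isTree_iff_connected_and_card]
      exact ⟨ht.1, by rw [Nat.card_eq_fintype_card (α := T.V), ht.2.2.2]⟩
    have hbr := SimpleGraph.isAcyclic_iff_forall_isBridge.1 htree.isAcyclic
      (T.toSimple.mem_edgeSet.2 hadj)
    rw [SimpleGraph.isBridge_iff] at hbr
    set G := T.toSimple.deleteEdges {s(u, v)} with hG
    -- In a tree `uv` is a bridge. With `h` the indicator of the side of `u`, `h (src) - h (tgt)` is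
    -- the signed crossing of that bridge, and balance makes the total vanish.
    let h : T.V → ℤ := fun x => if G.Reachable u x then 1 else 0
    have hu : h u = 1 := by simp [h]
    have hv : h v = 0 := by simp [h, hbr]
    have hstep : ∀ e, h (T.src e) - h (T.tgt e) =
        (if T.src e = u ∧ T.tgt e = v then 1 else 0) -
          (if T.src e = v ∧ T.tgt e = u then 1 else 0) := by
      intro e
      by_cases h1 : T.src e = u ∧ T.tgt e = v
      · rw [if_pos h1, h1.1, h1.2, hu, hv, if_neg]
        rintro ⟨h2, _⟩
        exact huv h2
      by_cases h2 : T.src e = v ∧ T.tgt e = u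
      · rw [if_pos h2, h2.1, h2.2, hu, hv, if_neg]
        rintro ⟨h3, _⟩
        exact huv h3.symm
      rw [if_neg h1, if_neg h2, sub_zero, sub_eq_zero]
      have hr : G.Reachable (T.src e) (T.tgt e) := by
        by_cases hl : T.src e = T.tgt e
        · rw [hl]
        · refine SimpleGraph.Adj.reachable ?_
          rw [hG, SimpleGraph.deleteEdges_adj]
          refine ⟨⟨hl, e, Or.inl ⟨rfl, rfl⟩⟩, ?_⟩
          rw [Set.mem_singleton_iff, Sym2.eq_iff]
          tauto
      have : G.Reachable u (T.src e) ↔ G.Reachable u (T.tgt e) :=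
        ⟨fun h => h.trans hr, fun h => h.trans hr.symm⟩
      simp only [h, this]
    have hsum : ∑ e, (h (T.src e) - h (T.tgt e)) = 0 := by
      rw [Finset.sum_sub_distrib, hT.balanced h, sub_self]
    simp_rw [hstep] at hsum
    rw [Finset.sum_sub_distrib, ← mult_eq_sum, ← mult_eq_sum, sub_eq_zero] at hsum
    exact_mod_cast hsum
  · have h0 : ∀ x y, ¬ T.toSimple.Adj x y → x ≠ y → T.mult x y = 0 := by
      intro x y hxy hne
      by_contra h
      obtain ⟨e, he⟩ := exists_of_mult_pos (Nat.pos_of_ne_zero h)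
      exact hxy ⟨hne, e, Or.inl he⟩
    rw [h0 u v hadj huv, h0 v u (fun h => hadj h.symm) (Ne.symm huv)]

lemma edgeSet_toSimple : T.toSimple.edgeSet =
    ↑((pairs T.ends Finset.univ).filter fun d => ¬ d.IsDiag) := by
  ext d
  induction d using Sym2.ind with
  | _ u v =>
    simp only [SimpleGraph.mem_edgeSet, toSimple, Finset.coe_filter, Set.mem_ofPred_eq, pairs, ends,
      Finset.mem_image, Finset.mem_univ, true_and, Sym2.mk_isDiag_iff, Sym2.eq_iff]
    exact and_comm

lemma card_edgeSet : Nat.card T.toSimple.edgeSet =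
    ((pairs T.ends Finset.univ).filter fun d => ¬ d.IsDiag).card := by
  rw [edgeSet_toSimple, Nat.card_coe_set_eq, Set.ncard_coe_finset]

lemma filter_not_isDiag_eq (h : ∀ e, T.src e ≠ T.tgt e) :
    ((pairs T.ends Finset.univ).filter fun d => ¬ d.IsDiag) = pairs T.ends Finset.univ := by
  refine Finset.filter_true_of_mem fun d hd => ?_
  rw [pairs, Finset.mem_image] at hd
  obtain ⟨e, _, rfl⟩ := hd
  exact h e

lemma IsThickTree.card_eq (ht : T.IsThickTree) :
    Fintype.card T.V = (pairs T.ends Finset.univ).card + 1 := by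
  rw [ht.2.2.2, card_edgeSet, filter_not_isDiag_eq ht.2.1]

/-- Connectedness gives at most one vertex more than simple edges. Once single edges are excluded,
failing to be a thick tree means either that this bound is strict or that there is a loop, which
adds a diagonal pair invisible to the simple graph. -/
lemma IsEulerian.card_le (hT : T.IsEulerian) (ht : ¬ T.IsThickTree)
    (hm : ∀ u v, u ≠ v → T.mult u v + T.mult v u ≠ 1) :
    Fintype.card T.V ≤ (pairs T.ends Finset.univ).card := by
  have hc := hT.toSimple_connected.card_vert_le_card_edgeSet_add_one
  rw [Nat.card_eq_fintype_card] at hc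
  by_cases hl : ∀ e, T.src e ≠ T.tgt e
  · have hne : Fintype.card T.V ≠ Nat.card T.toSimple.edgeSet + 1 := fun h =>
      ht ⟨hT.toSimple_connected, hl, hm, h⟩
    rw [card_edgeSet, filter_not_isDiag_eq hl] at hne hc
    omega
  · push Not at hl
    obtain ⟨e, he⟩ := hl
    have : ((pairs T.ends Finset.univ).filter fun d => ¬ d.IsDiag).card <
        (pairs T.ends Finset.univ).card := by
      refine Finset.card_lt_card (Finset.filter_ssubset.2 ⟨unordered (T.ends e), ?_, ?_⟩)
      · exact Finset.mem_image_of_mem (fun e => unordered (T.ends e)) (Finset.mem_univ e)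
      · rw [not_not]
        exact he
    rw [card_edgeSet] at hc
    omega

lemma IsEulerian.card_le_add_one (hT : T.IsEulerian) :
    Fintype.card T.V ≤ (pairs T.ends Finset.univ).card + 1 := by
  have hc := hT.toSimple_connected.card_vert_le_card_edgeSet_add_one
  rw [Nat.card_eq_fintype_card, card_edgeSet] at hc
  exact hc.trans (Nat.succ_le_succ (Finset.card_filter_le _ _))

/-- For a thick tree crossed symmetrically, `τ^e[T]` is a product over the edges of the tree. -/
lemma IsThickTree.tauLimit_eq (ht : T.IsThickTree) (hsymm : ∀ u v, T.mult u v = T.mult v u)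
    (C : ℕ → ℕ → ℝ) (ν : T.V ≃ Fin (Fintype.card T.V)) (c : Sym2 T.V → ℝ)
    (hc : ∀ u v, c s(u, v) = C (T.mult u v) (T.mult v u)) :
    T.tauLimit C ν = ∏ d ∈ pairs T.ends Finset.univ, c d := by
  classical
  rw [tauLimit, if_pos ht]
  -- One ordered pair per tree edge, lower vertex first; by symmetry of the multiplicities
  -- positivity in one direction detects the edge.
  let Q : Finset (T.V × T.V) := Finset.univ.filter fun p =>
    ν p.1 < ν p.2 ∧ 0 < T.mult p.1 p.2
  have hQ : ∏ d ∈ pairs T.ends Finset.univ, c d =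
      ∏ p ∈ Q, C (T.mult p.1 p.2) (T.mult p.2 p.1) := by
    symm
    refine Finset.prod_bij (fun p _ => s(p.1, p.2)) ?_ ?_ ?_ ?_
    · intro p hp
      obtain ⟨_, h1, h2⟩ := Finset.mem_filter.1 hp
      obtain ⟨e, he1, he2⟩ := exists_of_mult_pos h2
      rw [pairs, Finset.mem_image]
      exact ⟨e, Finset.mem_univ _, by rw [ends, he1, he2]⟩
    · intro p hp p' hp' h
      have h1 := (Finset.mem_filter.1 hp).2.1
      have h2 := (Finset.mem_filter.1 hp').2.1
      rw [Sym2.eq_iff] at h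
      rcases h with h | h
      · exact Prod.ext h.1 h.2
      · rw [h.1, h.2] at h1
        exact absurd h1 (not_lt.2 h2.le)
    · intro d hd
      rw [pairs, Finset.mem_image] at hd
      obtain ⟨e, _, rfl⟩ := hd
      have hpos : 0 < T.mult (T.src e) (T.tgt e) := mult_pos rfl rfl
      have hne : ν (T.src e) ≠ ν (T.tgt e) := fun h => ht.2.1 e (ν.injective h)
      rcases lt_or_gt_of_ne hne with h | h
      · exact ⟨(T.src e, T.tgt e), Finset.mem_filter.2 ⟨Finset.mem_univ _, h, hpos⟩, rfl⟩
      · refine ⟨(T.tgt e, T.src e), Finset.mem_filter.2 ⟨Finset.mem_univ _, h, ?_⟩, Sym2.eq_swap⟩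
        rw [hsymm]
        exact hpos
    · intro p _
      exact (hc _ _).symm
  rw [hQ, ← Finset.prod_product', ← Finset.prod_fiberwise_of_maps_to
    (t := Finset.range (Fintype.card T.E + 1) ×ˢ Finset.range (Fintype.card T.E + 1))
    (g := fun p : T.V × T.V => (T.mult p.1 p.2, T.mult p.2 p.1))]
  · refine Finset.prod_congr rfl fun x _ => ?_
    split_ifs with hx
    · rw [q, Fintype.card_subtype]
      symm
      have : Q.filter (fun p => (T.mult p.1 p.2, T.mult p.2 p.1) = x) =
          Finset.univ.filter fun p : T.V × T.V =>
            ν p.1 < ν p.2 ∧ T.mult p.1 p.2 = x.1 ∧ T.mult p.2 p.1 = x.2 := by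
        ext p
        simp only [Q, Finset.mem_filter, Finset.mem_univ, true_and, Prod.ext_iff]
        have := hsymm p.1 p.2
        constructor
        · rintro ⟨⟨h1, _⟩, h2, h3⟩
          exact ⟨h1, h2, h3⟩
        · rintro ⟨h1, h2, h3⟩
          exact ⟨⟨h1, by omega⟩, h2, h3⟩
      rw [this]
      refine Finset.prod_eq_pow_card fun p hp => ?_
      obtain ⟨_, _, h1, h2⟩ := Finset.mem_filter.1 hp
      rw [h1, h2]
    -- Symmetric positive multiplicities sum to at least 2, so this fibre is empty.
    · refine (Finset.prod_eq_one fun p hp => ?_).symm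
      exfalso
      obtain ⟨hpQ, rfl⟩ := Finset.mem_filter.1 hp
      have h1 := (Finset.mem_filter.1 hpQ).2.2
      have := hsymm p.1 p.2
      dsimp only at hx
      omega
  · intro p _
    simp only [Finset.mem_product, Finset.mem_range]
    exact ⟨Nat.lt_succ_of_le (mult_le _ _), Nat.lt_succ_of_le (mult_le _ _)⟩

lemma unordered_positions_eq_iff {N : ℕ} (φ : T.V ↪ Fin N) (e : T.E) (d : Sym2 T.V) :
    unordered (T.positions φ e) = d.map φ ↔ unordered (T.ends e) = d := by
  rw [← (Sym2.map.injective φ.injective).eq_iff]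
  rfl

lemma pairs_positions {N : ℕ} (φ : T.V ↪ Fin N) (S : Finset T.E) :
    pairs (T.positions φ) S = (pairs T.ends S).image (Sym2.map φ) := by
  rw [pairs, pairs, Finset.image_image]
  rfl

lemma card_pairs_positions {N : ℕ} (φ : T.V ↪ Fin N) (S : Finset T.E) :
    (pairs (T.positions φ) S).card = (pairs T.ends S).card := by
  rw [pairs_positions, Finset.card_image_of_injective _ (Sym2.map.injective φ.injective)]

lemma monomial_pair {N : ℕ} (M : Matrix (Fin N) (Fin N) ℝ) (φ : T.V ↪ Fin N) {u v : T.V}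
    (huv : u ≠ v) :
    monomial M (T.positions φ) (Finset.univ.filter fun e => unordered (T.ends e) = s(u, v)) =
      M (φ u) (φ v) ^ T.mult u v * M (φ v) (φ u) ^ T.mult v u := by
  classical
  rw [monomial_of_forall_eq _ _ _ (φ u) (φ v), mult, mult, Fintype.card_subtype,
    Fintype.card_subtype, Finset.filter_filter, Finset.filter_filter]
  · congr 3
    · ext e
      simp only [Finset.mem_filter, Finset.mem_univ, true_and, positions, Prod.ext_iff,
        φ.injective.eq_iff, ends, Sym2.eq_iff]
      tauto
    · ext e
      simp only [Finset.mem_filter, Finset.mem_univ, true_and, positions, Prod.ext_iff,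
        φ.injective.eq_iff, ends, Sym2.eq_iff]
      constructor
      · tauto
      · rintro ⟨h1, h2⟩
        exact ⟨Or.inr ⟨h1, h2⟩, fun h => huv (h.1.symm.trans h1)⟩
  · intro e he
    rw [← Sym2.map_mk, unordered_positions_eq_iff]
    exact (Finset.mem_filter.1 he).2

end Multidigraph

open Multidigraph

/-! ### Expected monomials of Eulerian graphs -/

lemma IsEllipticMatrix.integral_monomial_positions {Ω : Type*} [MeasurableSpace Ω] {N : ℕ}
    {P : Measure Ω} [IsProbabilityMeasure P] {A : Ω → Matrix (Fin N) (Fin N) ℝ}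
    (hA : IsEllipticMatrix P A) {T : Multidigraph} (φ : T.V ↪ Fin N) :
    ∫ ω, monomial (A ω) (T.positions φ) Finset.univ ∂P = ∏ d ∈ pairs T.ends Finset.univ,
      ∫ ω, monomial (A ω) (T.positions φ)
        (Finset.univ.filter fun e => unordered (T.ends e) = d) ∂P := by
  rw [hA.integral_monomial, pairs_positions,
    Finset.prod_image (Sym2.map.injective φ.injective).injOn]
  simp_rw [unordered_positions_eq_iff]

/-- The normalized expectation of the monomial of an Eulerian graph converges uniformly over
all injective labellings of its vertices. -/
lemma HasMomentLimits.tendsto_integral_monomial {Ω : ℕ → Type*} [∀ N, MeasurableSpace (Ω N)]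
    {P : ∀ N, Measure (Ω N)} [∀ N, IsProbabilityMeasure (P N)]
    {A : ∀ N, Ω N → Matrix (Fin N) (Fin N) ℝ} {C : ℕ → ℕ → ℝ} (hA : HasMomentLimits P A C)
    {T : Multidigraph} (hT : T.IsEulerian) (ν : T.V ≃ Fin (Fintype.card T.V)) :
    Tendsto (fun x : Σ N, T.V ↪ Fin N => (x.1 : ℝ) ^ Fintype.card T.V * (x.1 : ℝ)⁻¹ *
      ∫ ω, monomial (A x.1 ω) (T.positions x.2) Finset.univ ∂(P x.1))
      (comap Sigma.fst atTop) (𝓝 (T.tauLimit C ν)) := by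
  classical
  have hL : Tendsto (Sigma.fst : (Σ N, T.V ↪ Fin N) → ℕ) (comap Sigma.fst atTop) atTop :=
    tendsto_comap
  have hpos : ∀ᶠ x : Σ N, T.V ↪ Fin N in comap Sigma.fst atTop, 0 < x.1 :=
    hL.eventually_gt_atTop 0
  by_cases ht : T.IsThickTree
  · have hsymm := hT.mult_comm ht
    -- A weight on unordered edges makes sense only because the two multiplicities agree; `C` itself
    -- need not be symmetric.
    let c : Sym2 T.V → ℝ := Sym2.lift ⟨fun u v => C (T.mult u v) (T.mult v u), fun u v => by
      change C _ _ = C _ _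
      rw [hsymm u v]⟩
    rw [ht.tauLimit_eq hsymm C ν c fun u v => rfl]
    have hlim : ∀ d ∈ pairs T.ends Finset.univ, Tendsto (fun x : Σ N, T.V ↪ Fin N =>
        (x.1 : ℝ) * ∫ ω, monomial (A x.1 ω) (T.positions x.2)
          (Finset.univ.filter fun e => unordered (T.ends e) = d) ∂(P x.1))
        (comap Sigma.fst atTop) (𝓝 (c d)) := by
      intro d hd
      rw [pairs, Finset.mem_image] at hd
      obtain ⟨e, _, rfl⟩ := hd
      have huv : T.src e ≠ T.tgt e := ht.2.1 e
      change Tendsto _ _ (𝓝 (C (T.mult (T.src e) (T.tgt e)) (T.mult (T.tgt e) (T.src e))))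
      have hp : 0 < T.mult (T.src e) (T.tgt e) := mult_pos rfl rfl
      change Tendsto (fun x : Σ N, T.V ↪ Fin N =>
        (x.1 : ℝ) * ∫ ω, monomial (A x.1 ω) (T.positions x.2)
          (Finset.univ.filter fun e' => unordered (T.ends e') = s(T.src e, T.tgt e)) ∂(P x.1)) _ _
      simp_rw [monomial_pair _ _ huv]
      rw [hsymm (T.tgt e) (T.src e)]
      set k := T.mult (T.src e) (T.tgt e)
      intro s hs
      rw [Filter.mem_map]
      have := (hA.offDiag k k (by omega)).eventually hs
      rw [eventually_comap_fst] at this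
      change ∀ᶠ x in comap (Sigma.fst : (Σ N, T.V ↪ Fin N) → ℕ) atTop, _
      rw [eventually_comap_fst]
      filter_upwards [this] with N hN φ
      -- The labelling may reverse the order of the endpoints, while the moment limits are given for
      -- `i < j`; with equal exponents swapping the two factors repairs this.
      rcases lt_or_gt_of_ne (φ.injective.ne huv) with h | h
      · exact hN ⟨(_, _), h⟩
      · have := hN ⟨(_, _), h⟩
        have hswap : ∫ ω, A N ω (φ (T.src e)) (φ (T.tgt e)) ^ k *
            A N ω (φ (T.tgt e)) (φ (T.src e)) ^ k ∂(P N) = ∫ ω, A N ω (φ (T.tgt e)) (φ (T.src e)) ^ k *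
            A N ω (φ (T.src e)) (φ (T.tgt e)) ^ k ∂(P N) :=
          integral_congr_ae (Eventually.of_forall fun ω => mul_comm _ _)
        exact (congrArg (fun t => (N : ℝ) * t ∈ s) hswap).mpr this
    refine (tendsto_finsetProd _ hlim).congr' ?_
    -- A thick tree has `|V| - 1` pairs, which is exactly one factor `N` for each.
    filter_upwards [hpos] with x hx
    have hx0 : (x.1 : ℝ) ≠ 0 := by exact_mod_cast hx.ne'
    rw [Finset.prod_mul_distrib, Finset.prod_const, ht.card_eq, pow_succ, mul_assoc _ (x.1 : ℝ),
      mul_inv_cancel₀ hx0, mul_one, (hA.elliptic _).integral_monomial_positions]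
  · rw [tauLimit, if_neg ht]
    by_cases hm : ∀ u v, u ≠ v → T.mult u v + T.mult v u ≠ 1
    · have hcard := hT.card_le ht hm
      obtain ⟨K, hK1, hK⟩ := hA.exists_monomial_bound T.E
      have hinv : Tendsto (fun x : Σ N, T.V ↪ Fin N => K * (x.1 : ℝ)⁻¹)
          (comap Sigma.fst atTop) (𝓝 0) := by
        have := (tendsto_inv_atTop_zero.comp
          ((tendsto_natCast_atTop_atTop (R := ℝ)).comp hL)).const_mul K
        simpa using this
      refine squeeze_zero_norm' ?_ hinv
      filter_upwards [hpos, hL.eventually hK] with x hx hKx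
      have hx1 : (1 : ℝ) ≤ x.1 := by exact_mod_cast hx
      have hx0 : (0 : ℝ) < x.1 := by linarith
      have h1 := hKx (T.positions x.2) Finset.univ
      rw [card_pairs_positions] at h1
      rw [norm_mul, Real.norm_of_nonneg (by positivity), Real.norm_eq_abs]
      calc (x.1 : ℝ) ^ Fintype.card T.V * (x.1 : ℝ)⁻¹ * _
          ≤ (x.1 : ℝ) ^ (pairs T.ends Finset.univ).card * (x.1 : ℝ)⁻¹ *
            (K * ((x.1 : ℝ) ^ (pairs T.ends Finset.univ).card)⁻¹) := by
            gcongr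
        _ = K * (x.1 : ℝ)⁻¹ := by field_simp
    · push Not at hm
      obtain ⟨u, v, huv, h1⟩ := hm
      -- A pair joined by exactly one edge contributes the mean of an entry, so the expectation is
      -- exactly 0 for every `N`.
      refine tendsto_const_nhds.congr fun x => ?_
      rw [(hA.elliptic _).integral_monomial_positions, Finset.prod_eq_zero (i := s(u, v)), mul_zero]
      · rw [pairs, Finset.mem_image]
        have : 0 < T.mult u v ∨ 0 < T.mult v u := by omega
        rcases this with h | h
        · obtain ⟨e, he1, he2⟩ := exists_of_mult_pos h
          exact ⟨e, Finset.mem_univ _, by rw [ends, he1, he2]⟩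
        · obtain ⟨e, he1, he2⟩ := exists_of_mult_pos h
          exact ⟨e, Finset.mem_univ _, by rw [ends, he1, he2]; exact Sym2.eq_swap⟩
      · simp_rw [monomial_pair _ _ huv]
        have : (T.mult u v = 1 ∧ T.mult v u = 0) ∨ (T.mult u v = 0 ∧ T.mult v u = 1) := by omega
        rcases this with ⟨h, h'⟩ | ⟨h, h'⟩ <;> simp [h, h', (hA.elliptic _).mean]

/-! ### Cyclic graphs of partitions and their gluings -/

/-- The edges form a closed walk through all blocks: balance is reindexing by the cyclic shift, and
a function constant along edges is constant along the walk. -/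
lemma isEulerian_partitionGraph (π : CyclePartition) : (partitionGraph π).IsEulerian where
  nonempty := ⟨blockOf π.2 ⟨0, π.1.pos⟩⟩
  balanced h := (Equiv.sum_comp (finRotate (π.1 : ℕ)) fun m => h (blockOf π.2 m)).symm
  connected B h hh := by
    have key : ∀ m : Fin (π.1 : ℕ), h (blockOf π.2 m) = h (blockOf π.2 ⟨0, π.1.pos⟩) := by
      rintro ⟨m, hm⟩
      induction m with
      | zero => rfl
      | succ m ih =>
        rw [← ih (by omega)]
        have := hh (⟨m, by omega⟩ : Fin (π.1 : ℕ))
        refine Eq.trans ?_ this.symm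
        change _ = h (blockOf π.2 (finRotate _ _))
        congr 2
        have hpos : ∃ n, (π.1 : ℕ) = n + 1 := ⟨(π.1 : ℕ) - 1, by omega⟩
        obtain ⟨n, hn⟩ := hpos
        have gen : ∀ (k : ℕ) (hk : k = n + 1) (h1 : m + 1 < k) (h2 : m < k),
            (⟨m + 1, h1⟩ : Fin k) = finRotate k ⟨m, h2⟩ := by
          rintro k rfl h1 h2
          rw [finRotate_of_lt (by omega)]
        exact gen _ hn _ _
    intro u v
    obtain ⟨a, rfl⟩ := blockOf_surjective π.2 u
    obtain ⟨b, rfl⟩ := blockOf_surjective π.2 v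
    rw [key a, key b]
  src_surjective := blockOf_surjective π.2

/-- Balance and connectedness are phrased through test functions, which restrict to each half; the
common edge ties the two halves together. -/
lemma isEulerian_glue {T₁ T₂ : Multidigraph} (h₁ : T₁.IsEulerian) (h₂ : T₂.IsEulerian)
    {σ : VertexPartition T₁ T₂} (hσ : IsEdgeGluing σ) : (glue σ).IsEulerian where
  nonempty := by
    obtain ⟨v⟩ := h₁.nonempty
    exact ⟨blockOf σ (.inl v)⟩
  balanced h := by
    change ∑ e : T₁.E ⊕ T₂.E, h ((glue σ).src e) = ∑ e : T₁.E ⊕ T₂.E, h ((glue σ).tgt e)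
    rw [Fintype.sum_sum_type, Fintype.sum_sum_type]
    exact congrArg₂ _ (h₁.balanced fun v => h (blockOf σ (.inl v)))
      (h₂.balanced fun v => h (blockOf σ (.inr v)))
  connected B h hh := by
    have k₁ : ∀ u v, h (blockOf σ (.inl u)) = h (blockOf σ (.inl v)) :=
      h₁.connected B (fun v => h (blockOf σ (.inl v))) fun e => hh (Sum.inl e)
    have k₂ : ∀ u v, h (blockOf σ (.inr u)) = h (blockOf σ (.inr v)) :=
      h₂.connected B (fun v => h (blockOf σ (.inr v))) fun e => hh (Sum.inr e)
    have k₃ : ∃ u v, h (blockOf σ (.inl u)) = h (blockOf σ (.inr v)) := by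
      obtain ⟨_, e₁, e₂, he⟩ := hσ
      rw [Sym2.eq_iff] at he
      rcases he with he | he
      · exact ⟨T₁.src e₁, T₂.src e₂, congrArg h he.1⟩
      · exact ⟨T₁.src e₁, T₂.tgt e₂, congrArg h he.1⟩
    obtain ⟨u₀, v₀, h₀⟩ := k₃
    have k₄ : ∀ w, h (blockOf σ w) = h (blockOf σ (.inl u₀)) := by
      rintro (u | v)
      · exact k₁ _ _
      · rw [h₀]; exact k₂ _ _
    intro u v
    obtain ⟨a, rfl⟩ := blockOf_surjective σ u
    obtain ⟨b, rfl⟩ := blockOf_surjective σ v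
    rw [k₄ a, k₄ b]
  src_surjective := by
    intro w
    obtain ⟨a | a, rfl⟩ := blockOf_surjective σ w
    · obtain ⟨e, rfl⟩ := h₁.src_surjective a
      exact ⟨Sum.inl e, rfl⟩
    · obtain ⟨e, rfl⟩ := h₂.src_surjective a
      exact ⟨Sum.inr e, rfl⟩


open Multidigraph

/-! ### Averages over labellings -/

lemma tendsto_card_embedding_div (V : Type) [Fintype V] :
    Tendsto (fun N : ℕ => (Fintype.card (V ↪ Fin N) : ℝ) / (N : ℝ) ^ Fintype.card V) atTop
      (𝓝 1) := by
  classical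
  have h : ∀ i ∈ Finset.range (Fintype.card V),
      Tendsto (fun N : ℕ => ((N - i : ℕ) : ℝ) / N) atTop (𝓝 1) := by
    intro i _
    have h1 : Tendsto (fun N : ℕ => 1 - (i : ℝ) / N) atTop (𝓝 (1 - 0)) :=
      tendsto_const_nhds.sub (tendsto_const_div_atTop_nhds_zero_nat _)
    rw [sub_zero] at h1
    refine h1.congr' ?_
    filter_upwards [eventually_ge_atTop (i + 1)] with N hN
    have : (N : ℝ) ≠ 0 := by exact_mod_cast (by omega : N ≠ 0)
    rw [Nat.cast_sub (by omega)]
    field_simp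
  have := tendsto_finsetProd _ h
  simp only [Finset.prod_const_one] at this
  refine this.congr fun N => ?_
  rw [Fintype.card_embedding_eq, Fintype.card_fin, Nat.descFactorial_eq_prod_range]
  push_cast
  rw [Finset.prod_div_distrib, Finset.prod_const, Finset.card_range]

/-- Averages of a uniformly convergent quantity over injective labellings. -/
lemma tendsto_average_embedding (V : Type) [Fintype V] [DecidableEq V]
    {g : (Σ N, V ↪ Fin N) → ℝ} {c : ℝ} (hg : Tendsto g (comap Sigma.fst atTop) (𝓝 c)) :
    Tendsto (fun N : ℕ => ((N : ℝ) ^ Fintype.card V)⁻¹ * ∑ ψ : V ↪ Fin N, g ⟨N, ψ⟩) atTop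
      (𝓝 c) := by
  have hcard := tendsto_card_embedding_div V
  have h1 := hcard.mul_const c
  rw [one_mul] at h1
  have h2 : Tendsto (fun N : ℕ => ((N : ℝ) ^ Fintype.card V)⁻¹ *
      ∑ ψ : V ↪ Fin N, (g ⟨N, ψ⟩ - c)) atTop (𝓝 0) := by
    rw [Metric.tendsto_nhds]
    intro ε hε
    have h3 := (Metric.tendsto_nhds.1 hg) (ε / 2) (by positivity)
    rw [eventually_comap_fst] at h3
    filter_upwards [h3, hcard.eventually_lt_const (show (1 : ℝ) < 2 by norm_num)] with N hN hc
    rw [dist_zero_right, norm_mul, norm_inv, norm_pow, Real.norm_natCast]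
    calc ((N : ℝ) ^ Fintype.card V)⁻¹ * ‖∑ ψ : V ↪ Fin N, (g ⟨N, ψ⟩ - c)‖
        ≤ ((N : ℝ) ^ Fintype.card V)⁻¹ * (Fintype.card (V ↪ Fin N) * (ε / 2)) := by
          gcongr
          refine (norm_sum_le _ _).trans ?_
          rw [← nsmul_eq_mul, ← Finset.card_univ, ← Finset.sum_const]
          refine Finset.sum_le_sum fun ψ _ => ?_
          have := hN ψ
          rw [Real.dist_eq] at this
          exact this.le
      _ = (Fintype.card (V ↪ Fin N) : ℝ) / (N : ℝ) ^ Fintype.card V * (ε / 2) := by ring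
      _ < 2 * (ε / 2) := by gcongr
      _ = ε := by ring
  have h4 := h2.add h1
  rw [zero_add] at h4
  refine h4.congr fun N => ?_
  rw [Finset.sum_sub_distrib, Finset.sum_const, Finset.card_univ, nsmul_eq_mul]
  ring

/-! ### The limiting covariance -/

section Covariance

variable {Ω : Type*} [MeasurableSpace Ω] {N : ℕ} (P : Measure Ω)
  (A : Ω → Matrix (Fin N) (Fin N) ℝ)

/-- The centered monomial of a graph whose vertices are labelled by `φ`. -/
noncomputable def centeredMonomial (T : Multidigraph) (φ : T.V → Fin N) (ω : Ω) : ℝ :=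
  monomial (A ω) (T.positions φ) Finset.univ - ∫ ω', monomial (A ω') (T.positions φ) Finset.univ ∂P

/-- The fluctuation of `τ_N^e[T]`. -/
noncomputable def fluctuation (T : Multidigraph) (ω : Ω) : ℝ :=
  (√(N : ℝ))⁻¹ * ∑ φ : T.V ↪ Fin N, centeredMonomial P A T φ ω

variable {P A} [IsProbabilityMeasure P]

lemma hasAllMoments_centeredMonomial (hA : IsEllipticMatrix P A) (T : Multidigraph)
    (φ : T.V → Fin N) : HasAllMoments P (centeredMonomial P A T φ) :=
  (hA.hasAllMoments_monomial _ _).sub (HasAllMoments.const _)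

lemma hasAllMoments_fluctuation (hA : IsEllipticMatrix P A) (T : Multidigraph) :
    HasAllMoments P (fluctuation P A T) :=
  (HasAllMoments.sum _ fun _ _ => hasAllMoments_centeredMonomial hA T _).const_mul _

lemma isFunctionOf_centeredMonomial (T : Multidigraph) (φ : T.V → Fin N) :
    IsFunctionOf (pairEntries A) (pairs (T.positions φ) Finset.univ)
      (centeredMonomial P A T φ) :=
  (IsEllipticMatrix.isFunctionOf_monomial _ _).sub (IsFunctionOf.const _)

lemma integral_centeredMonomial (hA : IsEllipticMatrix P A) (T : Multidigraph)
    (φ : T.V → Fin N) : ∫ ω, centeredMonomial P A T φ ω ∂P = 0 := by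
  unfold centeredMonomial
  rw [integral_sub (hA.hasAllMoments_monomial _ _).integrable (integrable_const _)]
  simp

lemma integral_centeredMonomial_mul_eq_zero (hA : IsEllipticMatrix P A) {T₁ T₂ : Multidigraph}
    (φ₁ : T₁.V → Fin N) (φ₂ : T₂.V → Fin N)
    (h : Disjoint (pairs (T₁.positions φ₁) Finset.univ) (pairs (T₂.positions φ₂) Finset.univ)) :
    ∫ ω, centeredMonomial P A T₁ φ₁ ω * centeredMonomial P A T₂ φ₂ ω ∂P = 0 := by
  rw [IsFunctionOf.integral_mul hA.iIndepFun_pairEntries hA.measurable_pairEntries h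
    (isFunctionOf_centeredMonomial _ _) (isFunctionOf_centeredMonomial _ _),
    integral_centeredMonomial hA, zero_mul]

lemma integral_centeredMonomial_mul (hA : IsEllipticMatrix P A) {T₁ T₂ : Multidigraph}
    (φ₁ : T₁.V → Fin N) (φ₂ : T₂.V → Fin N) :
    ∫ ω, centeredMonomial P A T₁ φ₁ ω * centeredMonomial P A T₂ φ₂ ω ∂P =
      ∫ ω, monomial (A ω) (T₁.positions φ₁) Finset.univ *
        monomial (A ω) (T₂.positions φ₂) Finset.univ ∂P -
      (∫ ω, monomial (A ω) (T₁.positions φ₁) Finset.univ ∂P) *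
        ∫ ω, monomial (A ω) (T₂.positions φ₂) Finset.univ ∂P := by
  have h1 := hA.hasAllMoments_monomial (T₁.positions φ₁) Finset.univ
  have h2 := hA.hasAllMoments_monomial (T₂.positions φ₂) Finset.univ
  have := covariance_eq_sub (h1 2) (h2 2)
  rw [covariance] at this
  exact this

lemma integral_fluctuation_mul (hA : IsEllipticMatrix P A) (T₁ T₂ : Multidigraph) :
    ∫ ω, fluctuation P A T₁ ω * fluctuation P A T₂ ω ∂P =
      (N : ℝ)⁻¹ * ∑ φ₁ : T₁.V ↪ Fin N, ∑ φ₂ : T₂.V ↪ Fin N,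
        ∫ ω, centeredMonomial P A T₁ φ₁ ω * centeredMonomial P A T₂ φ₂ ω ∂P := by
  have hint : ∀ (φ₁ : T₁.V ↪ Fin N) (φ₂ : T₂.V ↪ Fin N), Integrable
      (fun ω => centeredMonomial P A T₁ φ₁ ω * centeredMonomial P A T₂ φ₂ ω) P := fun φ₁ φ₂ =>
    ((hasAllMoments_centeredMonomial hA T₁ φ₁).mul (hasAllMoments_centeredMonomial hA T₂ φ₂)).integrable
  have h : ∀ ω, fluctuation P A T₁ ω * fluctuation P A T₂ ω = (N : ℝ)⁻¹ *
      ∑ φ₁ : T₁.V ↪ Fin N, ∑ φ₂ : T₂.V ↪ Fin N,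
        centeredMonomial P A T₁ φ₁ ω * centeredMonomial P A T₂ φ₂ ω := by
    intro ω
    rw [fluctuation, fluctuation, mul_mul_mul_comm, ← mul_inv, Real.mul_self_sqrt (Nat.cast_nonneg N),
      Finset.sum_mul_sum]
  simp_rw [h]
  rw [integral_const_mul, integral_finsetSum _ fun φ₁ _ => integrable_finsetSum _ fun φ₂ _ => hint φ₁ φ₂]
  congr 1
  refine Finset.sum_congr rfl fun φ₁ _ => ?_
  rw [integral_finsetSum _ fun φ₂ _ => hint φ₁ φ₂]

/-- The covariance as a sum over all gluings along an edge. -/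
lemma sum_integral_centeredMonomial_mul (hA : IsEllipticMatrix P A) (T₁ T₂ : Multidigraph)
    [DecidablePred (IsEdgeGluing (T₁ := T₁) (T₂ := T₂))] :
    ∑ φ₁ : T₁.V ↪ Fin N, ∑ φ₂ : T₂.V ↪ Fin N,
        ∫ ω, centeredMonomial P A T₁ φ₁ ω * centeredMonomial P A T₂ φ₂ ω ∂P =
      ∑ σ : VertexPartition T₁ T₂ with IsEdgeGluing σ, ∑ ψ : (glue σ).V ↪ Fin N,
        ∫ ω, centeredMonomial P A T₁ (fun v => ψ (blockOf σ (.inl v))) ω *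
          centeredMonomial P A T₂ (fun v => ψ (blockOf σ (.inr v))) ω ∂P := by
  classical
  let c : (T₁.V → Fin N) → (T₂.V → Fin N) → ℝ := fun f₁ f₂ =>
    ∫ ω, centeredMonomial P A T₁ f₁ ω * centeredMonomial P A T₂ f₂ ω ∂P
  -- A pair of labellings is one function on the disjoint union, injective on each half; its level
  -- sets then form the gluing partition `σ`.
  have h1 : ∑ φ₁ : T₁.V ↪ Fin N, ∑ φ₂ : T₂.V ↪ Fin N, c φ₁ φ₂ =
      ∑ f : T₁.V ⊕ T₂.V → Fin N, if Function.Injective (fun v => f (.inl v)) ∧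
        Function.Injective (fun v => f (.inr v)) then
          c (fun v => f (.inl v)) (fun v => f (.inr v)) else 0 := by
    rw [Finset.sum_congr rfl fun (φ₁ : T₁.V ↪ Fin N) _ =>
      sum_embedding_eq_sum_ite (fun f₂ : T₂.V → Fin N => c φ₁ f₂),
      sum_embedding_eq_sum_ite (fun f₁ : T₁.V → Fin N => ∑ f₂ : T₂.V → Fin N,
      if Function.Injective f₂ then c f₁ f₂ else 0),
      ← (Equiv.sumArrowEquivProdArrow T₁.V T₂.V (Fin N)).symm.sum_comp, Fintype.sum_prod_type]
    refine Finset.sum_congr rfl fun f₁ _ => ?_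
    by_cases h : Function.Injective f₁
    · rw [if_pos h]
      refine Finset.sum_congr rfl fun f₂ _ => ?_
      by_cases h' : Function.Injective f₂
      · rw [if_pos h', if_pos]
        · rfl
        · exact ⟨h, h'⟩
      · rw [if_neg h', if_neg]
        rintro ⟨_, h2⟩
        exact h' h2
    · rw [if_neg h]
      refine (Finset.sum_eq_zero fun f₂ _ => if_neg ?_).symm
      rintro ⟨h2, _⟩
      exact h h2
  change ∑ φ₁ : T₁.V ↪ Fin N, ∑ φ₂ : T₂.V ↪ Fin N, c φ₁ φ₂ = _
  rw [h1, sum_functions_eq_sum_finpartition, Finset.sum_filter]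
  refine Finset.sum_congr rfl fun σ _ => ?_
  have hinj : ∀ ψ : {B // B ∈ σ.parts} ↪ Fin N,
      (Function.Injective (fun v => ψ (blockOf σ (.inl v))) ∧
        Function.Injective (fun v => ψ (blockOf σ (.inr v)))) ↔
      (∀ B ∈ σ.parts, (∀ u v, .inl u ∈ B → .inl v ∈ B → u = v) ∧
        (∀ u v, .inr u ∈ B → .inr v ∈ B → u = v)) := by
    intro ψ
    have hblock : ∀ (B : {B // B ∈ σ.parts}) w, w ∈ B.1 → blockOf σ w = B := fun B w hw =>
      Subtype.ext (σ.part_eq_of_mem B.2 hw)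
    constructor
    · rintro ⟨hl, hr⟩ B hB
      constructor
      · intro u v hu hv
        exact hl (by simp only [hblock ⟨B, hB⟩ _ hu, hblock ⟨B, hB⟩ _ hv])
      · intro u v hu hv
        exact hr (by simp only [hblock ⟨B, hB⟩ _ hu, hblock ⟨B, hB⟩ _ hv])
    · intro h
      constructor
      · intro u v huv
        have := (blockOf_eq_iff σ _ _).1 (ψ.injective huv)
        exact (h _ (σ.part_mem.2 (Finset.mem_univ _))).1 u v
          (σ.mem_part (Finset.mem_univ _)) this
      · intro u v huv
        have := (blockOf_eq_iff σ _ _).1 (ψ.injective huv)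
        exact (h _ (σ.part_mem.2 (Finset.mem_univ _))).2 u v
          (σ.mem_part (Finset.mem_univ _)) this
  by_cases hσ : IsEdgeGluing σ
  · rw [if_pos hσ]
    refine Finset.sum_congr rfl fun ψ _ => ?_
    rw [if_pos ((hinj ψ).2 hσ.1)]
    rfl
  · rw [if_neg hσ]
    refine Finset.sum_eq_zero fun ψ _ => ?_
    split_ifs with h
    -- With both halves injective, failing to be an edge gluing means that no pair of positions is
    -- shared, so the centered factors are independent.
    · refine integral_centeredMonomial_mul_eq_zero hA _ _ ?_
      rw [Finset.disjoint_left]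
      intro p hp hp'
      rw [pairs, Finset.mem_image] at hp hp'
      obtain ⟨e₁, _, rfl⟩ := hp
      obtain ⟨e₂, _, he⟩ := hp'
      refine hσ ⟨(hinj ψ).1 h, e₁, e₂, ?_⟩
      refine Sym2.map.injective ψ.injective ?_
      exact he.symm
    · rfl

end Covariance

/-! ### Glued graphs compared with their two halves -/

lemma monomial_glue {T₁ T₂ : Multidigraph} (σ : VertexPartition T₁ T₂) {N : ℕ}
    (M : Matrix (Fin N) (Fin N) ℝ) (ψ : (glue σ).V → Fin N) :
    monomial M (T₁.positions fun v => ψ (blockOf σ (.inl v))) Finset.univ *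
      monomial M (T₂.positions fun v => ψ (blockOf σ (.inr v))) Finset.univ =
      monomial M ((glue σ).positions ψ) Finset.univ := by
  symm
  change ∏ e : T₁.E ⊕ T₂.E, _ = _
  rw [Fintype.prod_sum_type]
  rfl

lemma card_pairs_glue {T₁ T₂ : Multidigraph} {σ : VertexPartition T₁ T₂} (hσ : IsEdgeGluing σ)
    {N : ℕ} (ψ : (glue σ).V ↪ Fin N) :
    (pairs (glue σ).ends Finset.univ).card + 1 ≤
      (pairs (T₁.positions fun v => ψ (blockOf σ (.inl v))) Finset.univ).card +
        (pairs (T₂.positions fun v => ψ (blockOf σ (.inr v))) Finset.univ).card := by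
  rw [← card_pairs_positions ψ, ← Finset.card_union_add_card_inter]
  refine Nat.add_le_add (Finset.card_le_card ?_) ?_
  · intro p hp
    rw [pairs, Finset.mem_image] at hp
    obtain ⟨e, _, rfl⟩ := hp
    rw [Finset.mem_union]
    rcases e with e | e
    · exact Or.inl (Finset.mem_image_of_mem
        (fun e => unordered (T₁.positions (fun v => ψ (blockOf σ (.inl v))) e)) (Finset.mem_univ e))
    · exact Or.inr (Finset.mem_image_of_mem
        (fun e => unordered (T₂.positions (fun v => ψ (blockOf σ (.inr v))) e)) (Finset.mem_univ e))
  · obtain ⟨_, e₁, e₂, he⟩ := hσ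
    refine Finset.card_pos.2 ⟨unordered (T₁.positions (fun v => ψ (blockOf σ (.inl v))) e₁), ?_⟩
    rw [Finset.mem_inter]
    refine ⟨Finset.mem_image_of_mem
        (fun e => unordered (T₁.positions (fun v => ψ (blockOf σ (.inl v))) e)) (Finset.mem_univ e₁), ?_⟩
    rw [pairs, Finset.mem_image]
    refine ⟨e₂, Finset.mem_univ _, ?_⟩
    exact (congrArg (Sym2.map ψ) he).symm

namespace HasMomentLimits

variable {Ω : ℕ → Type*} [∀ N, MeasurableSpace (Ω N)] {P : ∀ N, Measure (Ω N)}
  [∀ N, IsProbabilityMeasure (P N)] {A : ∀ N, Ω N → Matrix (Fin N) (Fin N) ℝ} {C : ℕ → ℕ → ℝ}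

/-- The mean of the product is the expected monomial of the glued graph, which yields `τ^e`. The
product of the means is `O(N^{-p₁-p₂})`, and the shared pair makes this negligible. -/
lemma tendsto_glued_covariance (hA : HasMomentLimits P A C) {T₁ T₂ : Multidigraph}
    (h₁ : T₁.IsEulerian) (h₂ : T₂.IsEulerian) {σ : VertexPartition T₁ T₂} (hσ : IsEdgeGluing σ)
    (ν : (glue σ).V ≃ Fin (Fintype.card (glue σ).V)) :
    Tendsto (fun x : Σ N, (glue σ).V ↪ Fin N =>
      (x.1 : ℝ) ^ Fintype.card (glue σ).V * (x.1 : ℝ)⁻¹ *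
        ∫ ω, centeredMonomial (P x.1) (A x.1) T₁ (fun v => x.2 (blockOf σ (.inl v))) ω *
          centeredMonomial (P x.1) (A x.1) T₂ (fun v => x.2 (blockOf σ (.inr v))) ω ∂(P x.1))
      (comap Sigma.fst atTop) (𝓝 ((glue σ).tauLimit C ν)) := by
  have hT := isEulerian_glue h₁ h₂ hσ
  have hmain := hA.tendsto_integral_monomial hT ν
  have hL : Tendsto (Sigma.fst : (Σ N, (glue σ).V ↪ Fin N) → ℕ) (comap Sigma.fst atTop) atTop :=
    tendsto_comap
  obtain ⟨K₁, hK₁, hb₁⟩ := hA.exists_monomial_bound T₁.E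
  obtain ⟨K₂, hK₂, hb₂⟩ := hA.exists_monomial_bound T₂.E
  have hrest : Tendsto (fun x : Σ N, (glue σ).V ↪ Fin N =>
      (x.1 : ℝ) ^ Fintype.card (glue σ).V * (x.1 : ℝ)⁻¹ *
        ((∫ ω, monomial (A x.1 ω) (T₁.positions fun v => x.2 (blockOf σ (.inl v))) Finset.univ
            ∂(P x.1)) *
          ∫ ω, monomial (A x.1 ω) (T₂.positions fun v => x.2 (blockOf σ (.inr v))) Finset.univ
            ∂(P x.1)))
      (comap Sigma.fst atTop) (𝓝 0) := by
    have hinv : Tendsto (fun x : Σ N, (glue σ).V ↪ Fin N => K₁ * K₂ * (x.1 : ℝ)⁻¹)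
        (comap Sigma.fst atTop) (𝓝 0) := by
      have := (tendsto_inv_atTop_zero.comp
        ((tendsto_natCast_atTop_atTop (R := ℝ)).comp hL)).const_mul (K₁ * K₂)
      simpa using this
    refine squeeze_zero_norm' ?_ hinv
    filter_upwards [hL.eventually_gt_atTop 0, hL.eventually hb₁, hL.eventually hb₂]
      with x hx hx₁ hx₂
    have hx1 : (1 : ℝ) ≤ x.1 := by exact_mod_cast hx
    have hx0 : (0 : ℝ) < x.1 := by linarith
    have h1 := hx₁ (T₁.positions fun v => x.2 (blockOf σ (.inl v))) Finset.univ
    have h2 := hx₂ (T₂.positions fun v => x.2 (blockOf σ (.inr v))) Finset.univ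
    have hcard := card_pairs_glue hσ x.2
    have hV := hT.card_le_add_one
    set p₁ := (pairs (T₁.positions fun v => x.2 (blockOf σ (.inl v))) Finset.univ).card
    set p₂ := (pairs (T₂.positions fun v => x.2 (blockOf σ (.inr v))) Finset.univ).card
    rw [norm_mul, norm_mul (∫ ω, _ ∂_), Real.norm_of_nonneg (by positivity), Real.norm_eq_abs,
      Real.norm_eq_abs]
    -- `|V| ≤ p + 1 ≤ p₁ + p₂`, where `p` counts the pairs of the glued graph; the remaining factor
    -- `1/N` then gives the decay.
    have hp : (x.1 : ℝ) ^ Fintype.card (glue σ).V ≤ (x.1 : ℝ) ^ p₁ * (x.1 : ℝ) ^ p₂ := by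
      rw [← pow_add]
      exact pow_le_pow_right₀ hx1 (by omega)
    calc _ ≤ ((x.1 : ℝ) ^ p₁ * (x.1 : ℝ) ^ p₂) * (x.1 : ℝ)⁻¹ *
          ((K₁ * ((x.1 : ℝ) ^ p₁)⁻¹) * (K₂ * ((x.1 : ℝ) ^ p₂)⁻¹)) := by
          gcongr
      _ = K₁ * K₂ * (x.1 : ℝ)⁻¹ := by field_simp
  have := hmain.sub hrest
  rw [sub_zero] at this
  refine this.congr fun x => ?_
  rw [integral_centeredMonomial_mul (hA.elliptic x.1)]
  simp_rw [monomial_glue]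
  ring

/-- Convergence of the covariances of the fluctuations. -/
lemma tendsto_covariance (hA : HasMomentLimits P A C)
    (ν : ∀ T : Multidigraph, T.V ≃ Fin (Fintype.card T.V)) (π₁ π₂ : CyclePartition) :
    Tendsto (fun N => ∫ ω, fluctuation (P N) (A N) (partitionGraph π₁) ω *
      fluctuation (P N) (A N) (partitionGraph π₂) ω ∂(P N)) atTop (𝓝 (limitCov C ν π₁ π₂)) := by
  classical
  have h : ∀ σ ∈ Finset.univ.filter
      (IsEdgeGluing (T₁ := partitionGraph π₁) (T₂ := partitionGraph π₂)), _ := fun σ hσ =>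
    tendsto_average_embedding (glue σ).V (hA.tendsto_glued_covariance (isEulerian_partitionGraph π₁)
      (isEulerian_partitionGraph π₂) (Finset.mem_filter.1 hσ).2 (ν (glue σ)))
  have hsum := tendsto_finsetSum _ h
  have hlim : limitCov C ν π₁ π₂ = ∑ σ ∈ Finset.univ.filter
      (IsEdgeGluing (T₁ := partitionGraph π₁) (T₂ := partitionGraph π₂)),
      (glue σ).tauLimit C (ν (glue σ)) := by
    unfold limitCov
    congr!
  rw [hlim]
  refine hsum.congr' ?_
  filter_upwards [eventually_gt_atTop 0] with N hN
  have hN0 : (N : ℝ) ≠ 0 := by exact_mod_cast hN.ne'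
  rw [integral_fluctuation_mul (hA.elliptic N), sum_integral_centeredMonomial_mul (hA.elliptic N),
    Finset.mul_sum]
  refine Finset.sum_congr rfl fun σ _ => ?_
  rw [← Finset.mul_sum, ← mul_assoc, ← mul_assoc, inv_mul_cancel₀ (pow_ne_zero _ hN0), one_mul]

end HasMomentLimits


open Multidigraph

/-! ### The asymptotic Wick formula -/

section Families

variable {r : ℕ} (T : Fin r → Multidigraph)

/-- The positions of the edges of a family of labelled graphs. -/
def familyPositions {N : ℕ} (φ : ∀ j, (T j).V → Fin N) (e : Σ j, (T j).E) : Fin N × Fin N :=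
  (T e.1).positions (φ e.1) e.2

/-- The unordered pairs of positions occupied by one graph of a family. -/
def familyPairs {N : ℕ} (φ : ∀ j, (T j).V → Fin N) (j : Fin r) : Finset (Sym2 (Fin N)) :=
  pairs ((T j).positions (φ j)) Finset.univ

variable {T}

lemma filter_fst_eq (j : Fin r) : (Finset.univ.filter fun e : Σ j, (T j).E => e.1 = j) =
    Finset.univ.map (Function.Embedding.sigmaMk j) := by
  ext ⟨i, e⟩
  simp only [Finset.mem_filter, Finset.mem_univ, true_and, Finset.mem_map,
    Function.Embedding.sigmaMk_apply]
  constructor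
  · rintro rfl
    exact ⟨e, rfl⟩
  · rintro ⟨e', he⟩
    exact (congrArg Sigma.fst he).symm

lemma centered_family {Ω : Type*} [MeasurableSpace Ω] {N : ℕ} (P : Measure Ω)
    (A : Ω → Matrix (Fin N) (Fin N) ℝ) (φ : ∀ j, (T j).V → Fin N) (j : Fin r) :
    centered P A (familyPositions T φ) Sigma.fst j = centeredMonomial P A (T j) (φ j) := by
  have h : ∀ M : Matrix (Fin N) (Fin N) ℝ, monomial M (familyPositions T φ)
      (Finset.univ.filter fun e => e.1 = j) = monomial M ((T j).positions (φ j)) Finset.univ := by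
    intro M
    rw [monomial, filter_fst_eq, Finset.prod_map]
    rfl
  funext ω
  simp only [centered, h, centeredMonomial]

lemma pairs_family {N : ℕ} (φ : ∀ j, (T j).V → Fin N) (B : Finset (Fin r)) :
    pairs (familyPositions T φ) (Finset.univ.filter fun e => e.1 ∈ B) =
      B.biUnion (familyPairs T φ) := by
  ext p
  simp only [pairs, familyPairs, Finset.mem_image, Finset.mem_filter, Finset.mem_univ, true_and,
    Finset.mem_biUnion]
  constructor
  · rintro ⟨⟨j, e⟩, hj, rfl⟩
    exact ⟨j, hj, e, rfl⟩
  · rintro ⟨j, hj, e, rfl⟩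
    exact ⟨⟨j, e⟩, hj, rfl⟩

lemma HasMomentLimits.exists_family_bound {Ω : ℕ → Type*} [∀ N, MeasurableSpace (Ω N)]
    {P : ∀ N, Measure (Ω N)} [∀ N, IsProbabilityMeasure (P N)]
    {A : ∀ N, Ω N → Matrix (Fin N) (Fin N) ℝ} {C : ℕ → ℕ → ℝ} (hA : HasMomentLimits P A C)
    (T : Fin r → Multidigraph) :
    ∃ K : ℝ, 1 ≤ K ∧ ∀ᶠ N in atTop, ∀ (φ : ∀ j, (T j).V → Fin N) (B : Finset (Fin r)),
      |∫ ω, ∏ j ∈ B, centeredMonomial (P N) (A N) (T j) (φ j) ω ∂(P N)| ≤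
        K * ((N : ℝ) ^ (B.biUnion (familyPairs T φ)).card)⁻¹ := by
  obtain ⟨K, hK1, hK⟩ := hA.exists_centered_bound (Σ j, (T j).E) (Fin r) Sigma.fst
  refine ⟨K, hK1, ?_⟩
  filter_upwards [hK] with N hN φ B
  have := hN (familyPositions T φ) B
  rw [pairs_family] at this
  simpa only [centered_family] using this

/-- Any number of common pairs of two graphs forces a common vertex. -/
lemma image_inter_nonempty {N : ℕ} {φ : ∀ j, (T j).V → Fin N} {i j : Fin r}
    (h : ¬ Disjoint (familyPairs T φ i) (familyPairs T φ j)) :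
    (Finset.univ.image (φ i) ∩ Finset.univ.image (φ j)).Nonempty := by
  rw [Finset.not_disjoint_iff] at h
  obtain ⟨p, hi, hj⟩ := h
  rw [familyPairs, pairs, Finset.mem_image] at hi hj
  obtain ⟨e, _, rfl⟩ := hi
  obtain ⟨e', _, he⟩ := hj
  refine ⟨φ i ((T i).src e), Finset.mem_inter.2 ⟨Finset.mem_image_of_mem _ (Finset.mem_univ _), ?_⟩⟩
  rw [Sym2.eq_iff] at he
  rcases he with he | he
  · change (φ j ((T j).src e') = φ i ((T i).src e)) ∧ _ at he
    rw [← he.1]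
    exact Finset.mem_image_of_mem _ (Finset.mem_univ _)
  · change _ ∧ (φ j ((T j).tgt e') = φ i ((T i).src e)) at he
    rw [← he.2]
    exact Finset.mem_image_of_mem _ (Finset.mem_univ _)

section Fixed

variable {Ω : Type*} [MeasurableSpace Ω] {N : ℕ} {P : Measure Ω} [IsProbabilityMeasure P]
  {A : Ω → Matrix (Fin N) (Fin N) ℝ}

/-- If the graphs only share positions with their partners, the mixed moment factorizes. -/
lemma integral_prod_eq_of_matching (hA : IsEllipticMatrix P A) (φ : ∀ j, (T j).V → Fin N)
    {s : Equiv.Perm (Fin r)} (hs : IsPairing s)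
    (hdisj : ∀ i j, i ≠ j → j ≠ s i → Disjoint (familyPairs T φ i) (familyPairs T φ j)) :
    ∫ ω, ∏ j, centeredMonomial P A (T j) (φ j) ω ∂P = ∏ i with i < s i,
      ∫ ω, centeredMonomial P A (T i) (φ i) ω * centeredMonomial P A (T (s i)) (φ (s i)) ω ∂P := by
  simp_rw [hs.prod_eq]
  refine IsFunctionOf.integral_prod hA.iIndepFun_pairEntries hA.measurable_pairEntries _
    (S := fun i => familyPairs T φ i ∪ familyPairs T φ (s i)) ?_ ?_
  · intro i hi j hj hij
    have hi' := (Finset.mem_filter.1 hi).2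
    have hj' := (Finset.mem_filter.1 hj).2
    have h1 : j ≠ s i := by
      rintro rfl
      exact (hs.lt_iff i).1 hj' hi'
    have h2 : i ≠ s j := by
      rintro rfl
      exact (hs.lt_iff j).1 hi' hj'
    have h3 : s i ≠ s j := s.injective.ne hij
    simp only [Finset.disjoint_union_left, Finset.disjoint_union_right]
    refine ⟨⟨hdisj i j hij h1, hdisj _ _ h1.symm ?_⟩, hdisj _ _ h2 h3.symm, hdisj _ _ h3 ?_⟩
    · rw [(hs i).2]; exact hij.symm
    · rw [(hs i).2]; exact h2.symm
  · intro i _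
    exact ((isFunctionOf_centeredMonomial _ _).mono Finset.subset_union_left).mul
      ((isFunctionOf_centeredMonomial _ _).mono Finset.subset_union_right)

/-- A factor sharing no pair with the others is independent of their product, and it is centered. -/
lemma integral_prod_eq_zero_of_isolated (hA : IsEllipticMatrix P A) (φ : ∀ j, (T j).V → Fin N)
    (j : Fin r) (hj : ∀ i, i ≠ j → Disjoint (familyPairs T φ j) (familyPairs T φ i)) :
    ∫ ω, ∏ i, centeredMonomial P A (T i) (φ i) ω ∂P = 0 := by
  simp_rw [← Finset.mul_prod_erase Finset.univ _ (Finset.mem_univ j)]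
  rw [IsFunctionOf.integral_mul hA.iIndepFun_pairEntries hA.measurable_pairEntries
    (T := (Finset.univ.erase j).biUnion (familyPairs T φ)) ?_
    (isFunctionOf_centeredMonomial (T j) (φ j))
    (IsFunctionOf.prod _ fun i hi => (isFunctionOf_centeredMonomial (T i) (φ i)).mono ?_),
    integral_centeredMonomial hA, zero_mul]
  · rw [Finset.disjoint_biUnion_right]
    intro i hi
    exact hj i (Finset.ne_of_mem_erase hi)
  · exact Finset.subset_biUnion_of_mem (familyPairs T φ) hi

lemma prod_pairs_eq_zero (hA : IsEllipticMatrix P A) (φ : ∀ j, (T j).V → Fin N)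
    {s : Equiv.Perm (Fin r)} (hs : IsPairing s) (j : Fin r)
    (hj : Disjoint (familyPairs T φ j) (familyPairs T φ (s j))) :
    ∏ i with i < s i, ∫ ω, centeredMonomial P A (T i) (φ i) ω *
      centeredMonomial P A (T (s i)) (φ (s i)) ω ∂P = 0 := by
  by_cases h : j < s j
  · exact Finset.prod_eq_zero (Finset.mem_filter.2 ⟨Finset.mem_univ j, h⟩)
      (integral_centeredMonomial_mul_eq_zero hA _ _ hj)
  · refine Finset.prod_eq_zero (i := s j) (Finset.mem_filter.2 ⟨Finset.mem_univ _, ?_⟩)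
      (integral_centeredMonomial_mul_eq_zero hA _ _ ?_)
    · rwa [hs.lt_iff]
    · rw [(hs j).2]
      exact hj.symm

open Classical in
/-- The error in Wick's formula for one labelling of the vertices. -/
lemma wick_error_le (hA : IsEllipticMatrix P A) (hT : ∀ j, (T j).IsEulerian) (hN : 0 < N) {K : ℝ}
    (hK1 : 1 ≤ K) (φ : ∀ j, (T j).V → Fin N)
    (hK : ∀ B : Finset (Fin r), |∫ ω, ∏ j ∈ B, centeredMonomial P A (T j) (φ j) ω ∂P| ≤
        K * ((N : ℝ) ^ (B.biUnion (familyPairs T φ)).card)⁻¹) :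
    (√(N : ℝ))⁻¹ ^ r * |∫ ω, ∏ j, centeredMonomial P A (T j) (φ j) ω ∂P -
      ∑ s : Equiv.Perm (Fin r) with IsPairing s, ∏ i with i < s i,
        ∫ ω, centeredMonomial P A (T i) (φ i) ω * centeredMonomial P A (T (s i)) (φ (s i)) ω ∂P| ≤
      (√(N : ℝ))⁻¹ * ((K + Fintype.card (Equiv.Perm (Fin r)) * K ^ r) *
        ((N : ℝ) ^ (Finset.univ.biUnion fun j => Finset.univ.image (φ j)).card)⁻¹) := by
  have hN1 : (1 : ℝ) ≤ N := by exact_mod_cast hN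
  have hrhs : 0 ≤ (√(N : ℝ))⁻¹ * ((K + Fintype.card (Equiv.Perm (Fin r)) * K ^ r) *
        ((N : ℝ) ^ (Finset.univ.biUnion fun j => Finset.univ.image (φ j)).card)⁻¹) := by
    positivity
  by_cases hiso : ∃ j, ∀ i, i ≠ j → Disjoint (familyPairs T φ j) (familyPairs T φ i)
  · obtain ⟨j, hj⟩ := hiso
    rw [integral_prod_eq_zero_of_isolated hA φ j hj, Finset.sum_eq_zero]
    · simpa using hrhs
    · intro s hs
      have hs' : IsPairing s := (Finset.mem_filter.1 hs).2
      exact prod_pairs_eq_zero hA φ hs' j (hj _ (hs' j).1)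
  push Not at hiso
  -- The parts are the vertex sets of the labelled graphs; a shared pair of positions forces a
  -- shared vertex.
  have hdich := two_mul_card_le_of_parts (Finset.univ.biUnion (familyPairs T φ))
    (fun j => Finset.univ.image (φ j))
    (fun j => by
      obtain ⟨v⟩ := (hT j).nonempty
      exact ⟨φ j v, Finset.mem_image_of_mem _ (Finset.mem_univ _)⟩)
    (fun j h hh a ha b hb => by
      rw [Finset.mem_image] at ha hb
      obtain ⟨u, _, rfl⟩ := ha
      obtain ⟨v, _, rfl⟩ := hb
      refine (hT j).connected (Fin N) (fun v => h (φ j v)) (fun e => hh _ _ ?_) u v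
      rw [Finset.mem_biUnion]
      exact ⟨j, Finset.mem_univ _, Finset.mem_image_of_mem
        (fun e => unordered ((T j).positions (φ j) e)) (Finset.mem_univ e)⟩)
    (fun j => by
      obtain ⟨i, hi, h⟩ := hiso j
      exact ⟨i, hi, image_inter_nonempty h⟩)
  rcases hdich with hcard | huniq
  · set v := (Finset.univ.biUnion fun j => Finset.univ.image (φ j)).card
    set p := (Finset.univ.biUnion (familyPairs T φ)).card
    rw [Fintype.card_fin] at hcard
    have hF := hK Finset.univ
    have hG : ∀ s ∈ Finset.univ.filter (IsPairing (r := r)), |∏ i with i < s i,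
        ∫ ω, centeredMonomial P A (T i) (φ i) ω * centeredMonomial P A (T (s i)) (φ (s i)) ω ∂P| ≤
        K ^ r * ((N : ℝ) ^ p)⁻¹ := by
      intro s hs
      have hs' : IsPairing s := (Finset.mem_filter.1 hs).2
      rw [Finset.abs_prod]
      have hpair : ∀ i ∈ Finset.univ.filter (fun i => i < s i),
          |∫ ω, centeredMonomial P A (T i) (φ i) ω *
            centeredMonomial P A (T (s i)) (φ (s i)) ω ∂P| ≤
          K * ((N : ℝ) ^ (({i, s i} : Finset (Fin r)).biUnion (familyPairs T φ)).card)⁻¹ := by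
        intro i _
        have := hK {i, s i}
        simpa only [Finset.prod_pair (hs' i).1.symm] using this
      refine (Finset.prod_le_prod (fun _ _ => abs_nonneg _) hpair).trans ?_
      rw [Finset.prod_mul_distrib, Finset.prod_const, Finset.prod_inv_distrib,
        Finset.prod_pow_eq_pow_sum]
      refine mul_le_mul (pow_le_pow_right₀ hK1 ?_) (inv_anti₀ (by positivity)
        (pow_le_pow_right₀ hN1 ?_)) (by positivity) (by positivity)
      · exact (Finset.card_le_univ _).trans (Fintype.card_fin r).le
      · refine le_trans (Finset.card_le_card ?_) Finset.card_biUnion_le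
        intro q hq
        rw [Finset.mem_biUnion] at hq
        obtain ⟨j, _, hj⟩ := hq
        rw [Finset.mem_biUnion]
        by_cases h : j < s j
        · exact ⟨j, Finset.mem_filter.2 ⟨Finset.mem_univ _, h⟩,
            Finset.mem_biUnion.2 ⟨j, by simp, hj⟩⟩
        · exact ⟨s j, Finset.mem_filter.2 ⟨Finset.mem_univ _, (hs'.lt_iff j).2 h⟩,
            Finset.mem_biUnion.2 ⟨j, by simp [(hs' j).2], hj⟩⟩
    -- In powers of `√N` this is `2v + 1 ≤ 2p + r`; the spare unit produces the factor `N^{-1/2}`.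
    have hscale : (√(N : ℝ))⁻¹ ^ r * ((N : ℝ) ^ p)⁻¹ ≤ (√(N : ℝ))⁻¹ * ((N : ℝ) ^ v)⁻¹ := by
      have hsq : (N : ℝ) = √(N : ℝ) ^ 2 := (Real.sq_sqrt (by positivity)).symm
      have hs1 : 1 ≤ √(N : ℝ) := Real.one_le_sqrt.2 hN1
      generalize √(N : ℝ) = t at hsq hs1
      rw [hsq, inv_pow, ← mul_inv, ← mul_inv, ← pow_mul, ← pow_mul, ← pow_add, ← pow_succ']
      exact inv_anti₀ (by positivity) (pow_le_pow_right₀ hs1 (by omega))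
    calc _ ≤ (√(N : ℝ))⁻¹ ^ r * (K * ((N : ℝ) ^ p)⁻¹ +
          Fintype.card (Equiv.Perm (Fin r)) * (K ^ r * ((N : ℝ) ^ p)⁻¹)) := by
          refine mul_le_mul_of_nonneg_left ((abs_sub _ _).trans (add_le_add hF ?_)) (by positivity)
          refine (Finset.abs_sum_le_sum_abs _ _).trans ((Finset.sum_le_sum hG).trans ?_)
          rw [Finset.sum_const, nsmul_eq_mul]
          gcongr
          exact Finset.card_le_univ _
      _ = (K + Fintype.card (Equiv.Perm (Fin r)) * K ^ r) *
          ((√(N : ℝ))⁻¹ ^ r * ((N : ℝ) ^ p)⁻¹) := by ring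
      _ ≤ (K + Fintype.card (Equiv.Perm (Fin r)) * K ^ r) *
          ((√(N : ℝ))⁻¹ * ((N : ℝ) ^ v)⁻¹) := by gcongr
      _ = _ := by ring
  -- Each graph now meets exactly one other, so choosing that neighbour is a fixed-point-free
  -- involution; any other pairing matches some graph with an independent one and contributes 0.
  · choose f hf hshare using hiso
    have hinv : Function.Involutive f := by
      intro j
      refine huniq (f j) _ _ (image_inter_nonempty (hshare (f j))) ?_ (hf _) (hf j).symm
      exact image_inter_nonempty fun h => hshare j h.symm
    let s₀ : Equiv.Perm (Fin r) := hinv.toPerm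
    have hs₀ : IsPairing s₀ := fun i => ⟨hf i, hinv i⟩
    have hdisj : ∀ i j, i ≠ j → j ≠ s₀ i → Disjoint (familyPairs T φ i) (familyPairs T φ j) := by
      intro i j hij hj
      by_contra h
      exact hj (huniq i _ _ (image_inter_nonempty h) (image_inter_nonempty (hshare i))
        hij.symm (hf i))
    have hsum : ∑ s : Equiv.Perm (Fin r) with IsPairing s, ∏ i with i < s i,
        ∫ ω, centeredMonomial P A (T i) (φ i) ω * centeredMonomial P A (T (s i)) (φ (s i)) ω ∂P =
        ∏ i with i < s₀ i, ∫ ω, centeredMonomial P A (T i) (φ i) ω *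
          centeredMonomial P A (T (s₀ i)) (φ (s₀ i)) ω ∂P := by
      refine Finset.sum_eq_single s₀ ?_ ?_
      · intro s hs hne
        have hs' : IsPairing s := (Finset.mem_filter.1 hs).2
        obtain ⟨j, hj⟩ := DFunLike.ne_iff.1 hne
        exact prod_pairs_eq_zero hA φ hs' j (hdisj _ _ (hs' j).1.symm hj)
      · intro h
        exact absurd (Finset.mem_filter.2 ⟨Finset.mem_univ _, hs₀⟩) h
    rw [integral_prod_eq_of_matching hA φ hs₀ hdisj, hsum, sub_self, abs_zero, mul_zero]
    exact hrhs

lemma integral_prod_fluctuation (hA : IsEllipticMatrix P A) :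
    ∫ ω, ∏ j, fluctuation P A (T j) ω ∂P = (√(N : ℝ))⁻¹ ^ r *
      ∑ φ : ∀ j, (T j).V ↪ Fin N, ∫ ω, ∏ j, centeredMonomial P A (T j) (φ j) ω ∂P := by
  have h : ∀ ω, ∏ j, fluctuation P A (T j) ω = (√(N : ℝ))⁻¹ ^ r *
      ∑ φ : ∀ j, (T j).V ↪ Fin N, ∏ j, centeredMonomial P A (T j) (φ j) ω := by
    intro ω
    simp_rw [fluctuation]
    rw [Finset.prod_mul_distrib, Finset.prod_const, Finset.card_univ, Fintype.card_fin,
      Finset.prod_univ_sum, Fintype.piFinset_univ]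
  simp_rw [h]
  rw [integral_const_mul, integral_finsetSum]
  intro φ _
  exact (HasAllMoments.prod _ fun j _ => hasAllMoments_centeredMonomial hA (T j) (φ j)).integrable

lemma prod_integral_fluctuation_mul (hA : IsEllipticMatrix P A) {s : Equiv.Perm (Fin r)}
    (hs : IsPairing s) :
    ∏ i with i < s i, ∫ ω, fluctuation P A (T i) ω * fluctuation P A (T (s i)) ω ∂P =
      (√(N : ℝ))⁻¹ ^ r * ∑ φ : ∀ j, (T j).V ↪ Fin N, ∏ i with i < s i,
        ∫ ω, centeredMonomial P A (T i) (φ i) ω *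
          centeredMonomial P A (T (s i)) (φ (s i)) ω ∂P := by
  simp_rw [integral_fluctuation_mul hA]
  rw [Finset.prod_mul_distrib, Finset.prod_const, hs.prod_sum_eq (fun i
    (φ : (T i).V ↪ Fin N) (χ : (T (s i)).V ↪ Fin N) =>
    ∫ ω, centeredMonomial P A (T i) φ ω * centeredMonomial P A (T (s i)) χ ω ∂P)]
  congr 1
  have hN : (N : ℝ)⁻¹ = (√(N : ℝ))⁻¹ ^ 2 := by
    rw [inv_pow, Real.sq_sqrt (Nat.cast_nonneg N)]
  rw [hN, ← pow_mul, hs.two_mul_card]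

end Fixed

/-- A tuple of labellings is a function on the disjoint union of the vertex sets, so the bound over
all functions applies and the error terms sum to `O(N^{-1/2})`. -/
lemma sum_inv_pow_card_vertices_le (T : Fin r → Multidigraph) (N : ℕ) :
    ∑ φ : ∀ j, (T j).V ↪ Fin N,
      ((N : ℝ) ^ (Finset.univ.biUnion fun j => Finset.univ.image (φ j)).card)⁻¹ ≤
      Fintype.card (Finpartition (Finset.univ : Finset (Σ j, (T j).V))) := by
  classical
  refine le_trans ?_ (sum_inv_pow_card_image_le (W := Σ j, (T j).V) N)
  let ι : (∀ j, (T j).V ↪ Fin N) → (Σ j, (T j).V) → Fin N := fun φ x => φ x.1 x.2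
  have hι : Function.Injective ι := by
    intro φ χ h
    funext j
    ext1 v
    exact congrFun h ⟨j, v⟩
  have himg : ∀ φ, (Finset.univ.biUnion fun j => Finset.univ.image (φ j)) =
      Finset.univ.image (ι φ) := by
    intro φ
    ext a
    simp [ι]
  simp_rw [himg]
  rw [← Finset.sum_image (f := fun f : (Σ j, (T j).V) → Fin N =>
    ((N : ℝ) ^ (Finset.univ.image f).card)⁻¹) (s := Finset.univ) (g := ι) hι.injOn]
  exact Finset.sum_le_sum_of_subset_of_nonneg (Finset.subset_univ _) fun _ _ _ => by positivity

end Families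

/-- The asymptotic Wick formula. -/
theorem HasMomentLimits.tendsto_wickSum {Ω : ℕ → Type*} [∀ N, MeasurableSpace (Ω N)]
    {P : ∀ N, Measure (Ω N)} [∀ N, IsProbabilityMeasure (P N)]
    {A : ∀ N, Ω N → Matrix (Fin N) (Fin N) ℝ} {C : ℕ → ℕ → ℝ} (hA : HasMomentLimits P A C)
    (ν : ∀ T : Multidigraph, T.V ≃ Fin (Fintype.card T.V)) {r : ℕ} (π : Fin r → CyclePartition) :
    Tendsto (fun N => ∫ ω, ∏ j, fluctuation (P N) (A N) (partitionGraph (π j)) ω ∂(P N)) atTop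
      (𝓝 (wickSum (limitCov C ν) π)) := by
  classical
  let T : Fin r → Multidigraph := fun j => partitionGraph (π j)
  have hT : ∀ j, (T j).IsEulerian := fun j => isEulerian_partitionGraph (π j)
  obtain ⟨K, hK1, hK⟩ := hA.exists_family_bound T
  have hmain : Tendsto (fun N => ∑ s : Equiv.Perm (Fin r) with IsPairing s, ∏ i with i < s i,
      ∫ ω, fluctuation (P N) (A N) (T i) ω * fluctuation (P N) (A N) (T (s i)) ω ∂(P N)) atTop
      (𝓝 (wickSum (limitCov C ν) π)) := by
    have : wickSum (limitCov C ν) π = ∑ s : Equiv.Perm (Fin r) with IsPairing s,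
        ∏ i with i < s i, limitCov C ν (π i) (π (s i)) := by
      unfold wickSum IsPairing
      congr!
    rw [this]
    exact tendsto_finsetSum _ fun s _ => tendsto_finsetProd _ fun i _ =>
      hA.tendsto_covariance ν (π i) (π (s i))
  set c : ℝ := (K + Fintype.card (Equiv.Perm (Fin r)) * K ^ r) *
    Fintype.card (Finpartition (Finset.univ : Finset (Σ j, (T j).V)))
  have herr : Tendsto (fun N => ∫ ω, ∏ j, fluctuation (P N) (A N) (T j) ω ∂(P N) -
      ∑ s : Equiv.Perm (Fin r) with IsPairing s, ∏ i with i < s i,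
        ∫ ω, fluctuation (P N) (A N) (T i) ω * fluctuation (P N) (A N) (T (s i)) ω ∂(P N)) atTop
      (𝓝 0) := by
    have hinv : Tendsto (fun N : ℕ => (√(N : ℝ))⁻¹ * c) atTop (𝓝 0) := by
      have := (tendsto_inv_atTop_zero.comp (Real.tendsto_sqrt_atTop.comp
        (tendsto_natCast_atTop_atTop (R := ℝ)))).mul_const c
      simpa using this
    refine squeeze_zero_norm' ?_ hinv
    filter_upwards [hK, eventually_gt_atTop 0] with N hKN hN
    rw [integral_prod_fluctuation (hA.elliptic N), Finset.sum_congr rfl fun s hs =>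
      prod_integral_fluctuation_mul (hA.elliptic N) (Finset.mem_filter.1 hs).2,
      ← Finset.mul_sum, ← mul_sub, Finset.sum_comm, ← Finset.sum_sub_distrib, Finset.mul_sum]
    refine (norm_sum_le _ _).trans ?_
    have hφ : ∀ φ : ∀ j, (T j).V ↪ Fin N, _ := fun φ =>
      wick_error_le (hA.elliptic N) hT hN hK1 (fun j => ⇑(φ j)) (hKN fun j => ⇑(φ j))
    calc _ ≤ ∑ φ : ∀ j, (T j).V ↪ Fin N, (√(N : ℝ))⁻¹ *
          ((K + Fintype.card (Equiv.Perm (Fin r)) * K ^ r) *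
          ((N : ℝ) ^ (Finset.univ.biUnion fun j => Finset.univ.image (φ j)).card)⁻¹) := by
          refine Finset.sum_le_sum fun φ _ => ?_
          rw [norm_mul, Real.norm_of_nonneg (by positivity), Real.norm_eq_abs]
          exact hφ φ
      _ = (√(N : ℝ))⁻¹ * ((K + Fintype.card (Equiv.Perm (Fin r)) * K ^ r) *
          ∑ φ : ∀ j, (T j).V ↪ Fin N,
          ((N : ℝ) ^ (Finset.univ.biUnion fun j => Finset.univ.image (φ j)).card)⁻¹) := by
          rw [Finset.mul_sum, Finset.mul_sum]
      _ ≤ (√(N : ℝ))⁻¹ * c := by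
          have := sum_inv_pow_card_vertices_le T N
          gcongr
          exact mul_le_mul_of_nonneg_left this (by positivity)
  have := herr.add hmain
  rw [zero_add] at this
  refine this.congr fun N => ?_
  rw [sub_add_cancel]


/-! ### Existence of Gaussian processes -/

/-- Independent standard Gaussian variables indexed by `ℕ`. -/
noncomputable def iidGaussian : Measure (ℕ → ℝ) := Measure.infinitePi fun _ => gaussianReal 0 1

instance : IsProbabilityMeasure iidGaussian := by
  unfold iidGaussian
  infer_instance

lemma map_eval_iidGaussian (m : ℕ) : iidGaussian.map (fun ω => ω m) = gaussianReal 0 1 :=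
  Measure.infinitePi_map_eval _ m

lemma iIndepFun_iidGaussian : iIndepFun (fun m (ω : ℕ → ℝ) => ω m) iidGaussian :=
  iIndepFun_infinitePi (X := fun _ (x : ℝ) => x) fun _ => measurable_id

lemma hasGaussianLaw_iidGaussian (m : ℕ) : HasGaussianLaw (fun ω : ℕ → ℝ => ω m) iidGaussian where
  isGaussian_map := by
    rw [map_eval_iidGaussian]
    infer_instance

lemma isGaussianProcess_iidGaussian :
    IsGaussianProcess (fun m (ω : ℕ → ℝ) => ω m) iidGaussian where
  hasGaussianLaw I := iIndepFun.hasGaussianLaw (X := fun (i : I) (ω : ℕ → ℝ) => ω i)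
    (fun i => hasGaussianLaw_iidGaussian i)
    (iIndepFun_iidGaussian.precomp (g := ((↑) : I → ℕ)) Subtype.val_injective)

lemma integral_iidGaussian (m : ℕ) : ∫ ω, ω m ∂iidGaussian = 0 := by
  have h : ∫ x, x ∂(iidGaussian.map fun ω => ω m) = ∫ ω, ω m ∂iidGaussian :=
    integral_map (measurable_pi_apply m).aemeasurable aestronglyMeasurable_id
  rw [← h, map_eval_iidGaussian, integral_id_gaussianReal]

lemma memLp_iidGaussian (m : ℕ) : MemLp (fun ω : ℕ → ℝ => ω m) 2 iidGaussian :=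
  (hasGaussianLaw_iidGaussian m).memLp (by simp)

lemma covariance_iidGaussian (m n : ℕ) :
    cov[fun ω : ℕ → ℝ => ω m, fun ω => ω n; iidGaussian] = if m = n then 1 else 0 := by
  split_ifs with h
  · subst h
    rw [covariance_self (measurable_pi_apply m).aemeasurable]
    have h : Var[fun x => x; iidGaussian.map fun ω => ω m] = Var[fun ω => ω m; iidGaussian] :=
      variance_map aemeasurable_id (measurable_pi_apply m).aemeasurable
    rw [← h, map_eval_iidGaussian]
    simp
  · exact (iIndepFun_iidGaussian.indepFun h).covariance_eq_zero (memLp_iidGaussian m)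
      (memLp_iidGaussian n)

/-- A linear image of the iid Gaussian sequence whose covariance is a given Gram kernel. -/
lemma exists_gaussianProcess_of_gram {ι H : Type} [NormedAddCommGroup H] [InnerProductSpace ℝ H]
    (e : ι → ℕ) (v : ℕ → H) :
    ∃ z : ι → (ℕ → ℝ) → ℝ, IsGaussianProcess z iidGaussian ∧
      (∀ i, ∫ ω, z i ω ∂iidGaussian = 0) ∧
      ∀ i j, cov[z i, z j; iidGaussian] = inner ℝ (v (e i)) (v (e j)) := by
  classical
  set g := InnerProductSpace.gramSchmidt ℝ v with hg
  -- Triangular coefficients of `v` in the Gram–Schmidt family. If `g m = 0` the quotient is 0 by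
  -- convention, and the term vanishes anyway.
  let M : ℕ → ℕ → ℝ := fun n m => if m = n then 1 else inner ℝ (g m) (v n) / ‖g m‖ ^ 2
  have hv : ∀ n, v n = ∑ m ∈ Finset.Iic n, M n m • g m := by
    intro n
    rw [← Finset.Iio_insert, Finset.sum_insert (by simp)]
    conv_lhs => rw [InnerProductSpace.gramSchmidt_def'' ℝ v n]
    simp only [M, if_true, one_smul]
    congr 1
    refine Finset.sum_congr rfl fun m hm => ?_
    rw [if_neg (Finset.mem_Iio.1 hm).ne]
    rfl
  -- The orthogonal vector `g m` is replaced by a Gaussian of standard deviation `‖g m‖`, so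
  -- covariances reproduce inner products.
  let z : ι → (ℕ → ℝ) → ℝ := fun i ω => ∑ m ∈ Finset.Iic (e i), M (e i) m * ‖g m‖ * ω m
  have hmem : ∀ n m, MemLp (fun ω : ℕ → ℝ => M n m * ‖g m‖ * ω m) 2 iidGaussian := fun n m =>
    (memLp_iidGaussian m).const_mul _
  refine ⟨z, ?_, ?_, ?_⟩
  · refine isGaussianProcess_iidGaussian.of_isGaussianProcess fun i =>
      ⟨Finset.Iic (e i), ∑ m : Finset.Iic (e i), (M (e i) m * ‖g m‖) •
        ContinuousLinearMap.proj (R := ℝ) (φ := fun _ : Finset.Iic (e i) => ℝ) m, fun ω => ?_⟩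
    simp only [z]
    rw [← Finset.sum_coe_sort]
    simp
  · intro i
    simp only [z]
    rw [integral_finsetSum _ fun m _ => (hmem (e i) m).integrable one_le_two]
    refine Finset.sum_eq_zero fun m _ => ?_
    rw [integral_const_mul, integral_iidGaussian, mul_zero]
  · intro i j
    simp only [z]
    rw [covariance_fun_sum_fun_sum' (fun m _ => hmem (e i) m) (fun m _ => hmem (e j) m), hv (e i),
      hv (e j), sum_inner]
    refine Finset.sum_congr rfl fun m _ => ?_
    rw [inner_sum]
    refine Finset.sum_congr rfl fun m' _ => ?_
    rw [covariance_const_mul_left, covariance_const_mul_right, covariance_iidGaussian,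
      real_inner_smul_left, real_inner_smul_right]
    split_ifs with h
    · subst h
      rw [real_inner_self_eq_norm_sq]
      ring
    · rw [InnerProductSpace.gramSchmidt_orthogonal ℝ v h]
      ring

/-- A symmetric positive semidefinite kernel is a Gram kernel. -/
lemma exists_gram {ι : Type} (K : ι → ι → ℝ) (hsymm : ∀ i j, K i j = K j i)
    (hpos : ∀ c : ι →₀ ℝ, 0 ≤ c.sum fun i a => c.sum fun j b => a * b * K i j) :
    ∃ (H : Type) (_ : NormedAddCommGroup H) (_ : InnerProductSpace ℝ H) (v : ι → H),
      ∀ i j, inner ℝ (v i) (v j) = K i j := by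
  -- The kernel defines a possibly degenerate inner product on formal linear combinations; null
  -- vectors are removed afterwards by the separation quotient.
  let core : PreInnerProductSpace.Core ℝ (ι →₀ ℝ) :=
    { inner := fun x y => x.sum fun i a => y.sum fun j b => a * b * K i j
      conj_inner_symm := by
        intro x y
        simp only [Finsupp.sum, conj_trivial]
        rw [Finset.sum_comm]
        refine Finset.sum_congr rfl fun i _ => Finset.sum_congr rfl fun j _ => ?_
        rw [hsymm j i]
        ring
      re_inner_nonneg := fun x => hpos x
      add_left := by
        intro x y z
        refine Finsupp.sum_add_index' (fun i => ?_) (fun i a b => ?_)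
        · simp [Finsupp.sum]
        · simp only [Finsupp.sum, ← Finset.sum_add_distrib]
          refine Finset.sum_congr rfl fun j _ => ?_
          ring
      smul_left := by
        intro x y r
        change (r • x).sum _ = (starRingEnd ℝ) r * x.sum _
        rw [Finsupp.sum_smul_index' (fun i => by simp [Finsupp.sum]), conj_trivial, Finsupp.mul_sum]
        refine Finset.sum_congr rfl fun i _ => ?_
        simp only [Finsupp.sum, Finset.mul_sum, smul_eq_mul]
        refine Finset.sum_congr rfl fun j _ => ?_
        ring }
  let _ : SeminormedAddCommGroup (ι →₀ ℝ) :=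
    InnerProductSpace.Core.toSeminormedAddCommGroup (𝕜 := ℝ)
  let _ : InnerProductSpace ℝ (ι →₀ ℝ) := InnerProductSpace.ofCore core
  refine ⟨SeparationQuotient (ι →₀ ℝ), inferInstance, inferInstance,
    fun i => SeparationQuotient.mk (Finsupp.single i 1), fun i j => ?_⟩
  rw [SeparationQuotient.inner_mk_mk]
  change (Finsupp.single i (1 : ℝ)).sum (fun i a => (Finsupp.single j (1 : ℝ)).sum
    fun j b => a * b * K i j) = K i j
  rw [Finsupp.sum_single_index, Finsupp.sum_single_index] <;> simp

/-- Existence of centered Gaussian processes on countable index sets. -/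
theorem exists_gaussianProcess {ι : Type} [Countable ι] (K : ι → ι → ℝ)
    (hsymm : ∀ i j, K i j = K j i)
    (hpos : ∀ c : ι →₀ ℝ, 0 ≤ c.sum fun i a => c.sum fun j b => a * b * K i j) :
    ∃ z : ι → (ℕ → ℝ) → ℝ, IsGaussianProcess z iidGaussian ∧
      (∀ i, ∫ ω, z i ω ∂iidGaussian = 0) ∧ ∀ i j, cov[z i, z j; iidGaussian] = K i j := by
  obtain ⟨H, _, _, v, hv⟩ := exists_gram K hsymm hpos
  obtain ⟨e, he⟩ := Countable.exists_injective_nat ι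
  obtain ⟨z, h1, h2, h3⟩ := exists_gaussianProcess_of_gram e (Function.extend e v 0)
  refine ⟨z, h1, h2, fun i j => ?_⟩
  rw [h3, he.extend_apply, he.extend_apply, hv]

/-! ### Convergence of characteristic functions from convergence of moments -/

/-- The derivative of the Taylor remainder is `I` times the preceding remainder, so the bounds
integrate inductively. For `n = 0` the exponential has modulus 1. -/
lemma norm_cexp_mul_I_sub_sum_le_of_nonneg (n : ℕ) {y : ℝ} (hy : 0 ≤ y) :
    ‖Complex.exp (y * Complex.I) - ∑ k ∈ Finset.range n, (y * Complex.I) ^ k / k.factorial‖ ≤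
      y ^ n / n.factorial := by
  induction n generalizing y with
  | zero => simp [Complex.norm_exp_ofReal_mul_I]
  | succ n ih =>
    let f : ℝ → ℂ := fun y => Complex.exp (y * Complex.I) -
      ∑ k ∈ Finset.range (n + 1), (y * Complex.I) ^ k / k.factorial
    let f' : ℝ → ℂ := fun y => Complex.I * (Complex.exp (y * Complex.I) -
      ∑ k ∈ Finset.range n, (y * Complex.I) ^ k / k.factorial)
    have hlin : ∀ x : ℝ, HasDerivAt (fun y : ℝ => (y : ℂ) * Complex.I) Complex.I x := by
      intro x
      simpa using (Complex.ofRealCLM.hasDerivAt (x := x)).mul_const Complex.I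
    have hf : ∀ x, HasDerivAt f (f' x) x := by
      intro x
      have h1 := (hlin x).cexp
      have h2 : ∀ k ∈ Finset.range n, HasDerivAt
          (fun y : ℝ => ((y : ℂ) * Complex.I) ^ (k + 1) / (k + 1).factorial)
          (Complex.I * ((x * Complex.I) ^ k / k.factorial)) x := by
        intro k _
        have := ((hlin x).pow (k + 1)).div_const ((k + 1).factorial : ℂ)
        convert! this using 1
        have h3 : (k.factorial : ℂ) ≠ 0 := by exact_mod_cast k.factorial_ne_zero
        have h4 : (k : ℂ) + 1 ≠ 0 := by exact_mod_cast k.succ_ne_zero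
        rw [Nat.factorial_succ]
        push_cast
        field_simp
      have h3 := HasDerivAt.fun_sum h2
      have h4 := (h1.sub h3).sub_const 1
      have e1 : f = fun y : ℝ => Complex.exp (y * Complex.I) -
          ∑ k ∈ Finset.range n, ((y : ℂ) * Complex.I) ^ (k + 1) / (k + 1).factorial - 1 := by
        funext y
        simp only [f]
        rw [Finset.sum_range_succ']
        simp
        ring
      rw [e1]
      convert! h4 using 1
      simp only [f']
      rw [mul_sub, Finset.mul_sum, mul_comm]
    have hB : ∀ x : ℝ, HasDerivAt (fun y : ℝ => y ^ (n + 1) / (n + 1).factorial)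
        (x ^ n / n.factorial) x := by
      intro x
      have := (hasDerivAt_pow (n + 1) x).div_const ((n + 1).factorial : ℝ)
      convert! this using 1
      have h3 : (n.factorial : ℝ) ≠ 0 := by positivity
      rw [Nat.factorial_succ]
      push_cast
      field_simp
    have := image_norm_le_of_norm_deriv_right_le_deriv_boundary (f := f) (f' := f') (a := 0) (b := y)
      (B := fun y : ℝ => y ^ (n + 1) / (n + 1).factorial) (B' := fun x => x ^ n / n.factorial)
      (fun x _ => (hf x).continuousAt.continuousWithinAt) (fun x _ => (hf x).hasDerivWithinAt)
      (by
        simp only [f]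
        rw [Finset.sum_range_succ']
        simp) hB
      (fun x hx => by
        simp only [f']
        rw [norm_mul, Complex.norm_I, one_mul]
        exact ih hx.1)
    exact this ⟨hy, le_rfl⟩

lemma norm_cexp_mul_I_sub_sum_le (n : ℕ) (y : ℝ) :
    ‖Complex.exp (y * Complex.I) - ∑ k ∈ Finset.range n, (y * Complex.I) ^ k / k.factorial‖ ≤
      |y| ^ n / n.factorial := by
  rcases le_total 0 y with hy | hy
  · rw [abs_of_nonneg hy]
    exact norm_cexp_mul_I_sub_sum_le_of_nonneg n hy
  · have := norm_cexp_mul_I_sub_sum_le_of_nonneg n (neg_nonneg.2 hy)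
    rw [abs_of_nonpos hy, ← RCLike.norm_conj]
    convert! this using 2
    simp only [map_sub, map_sum, map_div₀, map_pow, map_mul, Complex.conj_ofReal, Complex.conj_I,
      Complex.ofReal_neg, ← Complex.exp_conj, map_natCast, mul_neg, neg_mul]

/-- If the moments of `Y N` converge to those of a Gaussian variable, so does the expectation of
`exp (i Y N)`. -/
theorem tendsto_integral_cexp_of_moments {Ω : ℕ → Type*} [∀ N, MeasurableSpace (Ω N)]
    {P : ∀ N, Measure (Ω N)} [∀ N, IsProbabilityMeasure (P N)] {Y : ∀ N, Ω N → ℝ}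
    (hY : ∀ N, HasAllMoments (P N) (Y N)) {v : ℝ} {m : ℕ → ℝ}
    (hm : ∀ k, Tendsto (fun N => ∫ ω, Y N ω ^ k ∂(P N)) atTop (𝓝 (m k)))
    (hodd : ∀ n, m (2 * n + 1) = 0)
    (heven : ∀ n, m (2 * n) = (2 * n).factorial / (2 ^ n * n.factorial) * v ^ n) :
    Tendsto (fun N => ∫ ω, Complex.exp (Y N ω * Complex.I) ∂(P N)) atTop
      (𝓝 (Complex.exp (-(v : ℂ) / 2))) := by
  have hpow : ∀ N k, HasAllMoments (P N) (fun ω => Y N ω ^ k) := by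
    intro N k
    simpa using HasAllMoments.prod (Finset.range k) (f := fun _ => Y N) fun _ _ => hY N
  let a : ℕ → ℕ → ℂ := fun n N => ∑ k ∈ Finset.range (2 * n),
    Complex.I ^ k / k.factorial * ((∫ ω, Y N ω ^ k ∂(P N) : ℝ) : ℂ)
  have ha : ∀ n, Tendsto (a n) atTop (𝓝 (∑ k ∈ Finset.range n,
      (-(v : ℂ) / 2) ^ k / k.factorial)) := by
    intro n
    have h1 : ∑ k ∈ Finset.range n, (-(v : ℂ) / 2) ^ k / k.factorial =
        ∑ k ∈ Finset.range (2 * n), Complex.I ^ k / k.factorial * (m k : ℂ) := by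
      induction n with
      | zero => simp
      | succ n ih =>
        rw [Finset.sum_range_succ, ih, mul_add, mul_one, Finset.sum_range_succ,
          Finset.sum_range_succ, hodd, heven, pow_mul, Complex.I_sq]
        have h3 : (n.factorial : ℂ) ≠ 0 := by exact_mod_cast n.factorial_ne_zero
        have h4 : ((2 * n).factorial : ℂ) ≠ 0 := by exact_mod_cast (2 * n).factorial_ne_zero
        push_cast
        rw [div_pow, neg_pow]
        field_simp
        ring
    rw [h1]
    exact tendsto_finsetSum _ fun k _ =>
      ((Complex.continuous_ofReal.tendsto _).comp (hm k)).const_mul _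
  -- The Taylor polynomial is cut at an even degree so that the error is a genuine moment, without
  -- absolute values.
  have herr : ∀ n N, ‖∫ ω, Complex.exp (Y N ω * Complex.I) ∂(P N) - a n N‖ ≤
      (∫ ω, Y N ω ^ (2 * n) ∂(P N)) / (2 * n).factorial := by
    intro n N
    have hmeas : AEStronglyMeasurable (Y N) (P N) := (hY N).integrable.aestronglyMeasurable
    have hexp : Integrable (fun ω => Complex.exp (Y N ω * Complex.I)) (P N) := by
      refine (integrable_const (1 : ℝ)).mono' ?_ (Eventually.of_forall fun ω => ?_)
      · exact (by fun_prop : Continuous fun x : ℝ => Complex.exp (x * Complex.I)).comp_aestronglyMeasurable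
          hmeas
      · rw [Complex.norm_exp_ofReal_mul_I]
    have hterm : ∀ k ∈ Finset.range (2 * n),
        Integrable (fun ω => (Y N ω * Complex.I) ^ k / (k.factorial : ℂ)) (P N) := by
      intro k _
      have := ((hpow N k).integrable.ofReal (𝕜 := ℂ)).mul_const (Complex.I ^ k / k.factorial)
      refine this.congr (Eventually.of_forall fun ω => ?_)
      simp only [Complex.coe_algebraMap, Complex.ofReal_pow]
      rw [mul_pow]
      ring
    have h1 : a n N = ∫ ω, ∑ k ∈ Finset.range (2 * n),
        (Y N ω * Complex.I) ^ k / (k.factorial : ℂ) ∂(P N) := by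
      rw [integral_finsetSum _ hterm]
      refine Finset.sum_congr rfl fun k _ => ?_
      rw [← integral_complex_ofReal, ← integral_const_mul]
      refine integral_congr_ae (Eventually.of_forall fun ω => ?_)
      simp only
      push_cast
      ring
    rw [h1, ← integral_sub hexp (integrable_finsetSum _ hterm), ← integral_div]
    refine norm_integral_le_of_norm_le ((hpow N (2 * n)).integrable.div_const _)
      (Eventually.of_forall fun ω => ?_)
    refine (norm_cexp_mul_I_sub_sum_le (2 * n) (Y N ω)).trans_eq ?_
    rw [pow_mul, sq_abs, ← pow_mul]
  rw [Metric.tendsto_nhds]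
  intro ε hε
  have hexp : Tendsto (fun n => ∑ k ∈ Finset.range n, (-(v : ℂ) / 2) ^ k / k.factorial) atTop
      (𝓝 (Complex.exp (-(v : ℂ) / 2))) := by
    rw [Complex.exp_eq_exp_ℂ]
    exact (NormedSpace.expSeries_div_hasSum_exp (-(v : ℂ) / 2)).tendsto_sum_nat
  -- The limiting error bound `(v/2)^n / n!` tends to 0, so the degree is fixed first and only then
  -- `N` is sent to infinity.
  have hsmall := FloorSemiring.tendsto_pow_div_factorial_atTop (v / 2)
  obtain ⟨n, hn1, hn2⟩ := ((Metric.tendsto_nhds.1 hexp (ε / 3) (by positivity)).and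
    (hsmall.eventually_lt_const (show (0 : ℝ) < ε / 3 by positivity))).exists
  have hlim : Tendsto (fun N => (∫ ω, Y N ω ^ (2 * n) ∂(P N)) / (2 * n).factorial) atTop
      (𝓝 ((v / 2) ^ n / n.factorial)) := by
    have h1 := (hm (2 * n)).div_const ((2 * n).factorial : ℝ)
    have h2 : m (2 * n) / (2 * n).factorial = (v / 2) ^ n / n.factorial := by
      have h4 : ((2 * n).factorial : ℝ) ≠ 0 := by positivity
      rw [heven, div_pow]
      field_simp
    rwa [h2] at h1
  filter_upwards [hlim.eventually_lt_const hn2,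
    Metric.tendsto_nhds.1 (ha n) (ε / 3) (by positivity)] with N hN1 hN2
  calc dist (∫ ω, Complex.exp (Y N ω * Complex.I) ∂(P N)) (Complex.exp (-(v : ℂ) / 2))
      ≤ dist (∫ ω, Complex.exp (Y N ω * Complex.I) ∂(P N)) (a n N) + dist (a n N) _ +
        dist _ (Complex.exp (-(v : ℂ) / 2)) := dist_triangle4 _ _ _ _
    _ < ε / 3 + ε / 3 + ε / 3 := by
        refine add_lt_add (add_lt_add ?_ hN2) hn1
        rw [dist_eq_norm]
        exact (herr n N).trans_lt hN1
    _ = ε := by ring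


open Multidigraph

/-! ### From exploding moments to moment limits -/

lemma natCast_mul_one_div_sqrt_pow {N : ℕ} (hN : 0 < N) (n : ℕ) :
    (N : ℝ) * (1 / √(N : ℝ)) ^ n = ((N : ℝ) ^ ((n : ℝ) / 2 - 1))⁻¹ := by
  have h : (0 : ℝ) < N := by exact_mod_cast hN
  rw [Real.rpow_sub h, Real.rpow_one, inv_div, Real.sqrt_eq_rpow, div_eq_mul_one_div (n : ℝ),
    mul_comm (n : ℝ), Real.rpow_mul h.le, Real.rpow_natCast, one_div_pow, mul_one_div]

lemma IsEllipticExploding.hasMomentLimits {Ω : ℕ → Type*} [∀ N, MeasurableSpace (Ω N)]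
    {P : ∀ N, Measure (Ω N)} [∀ N, IsProbabilityMeasure (P N)]
    {X : ∀ N, Ω N → Matrix (Fin N) (Fin N) ℝ} {C : ℕ → ℕ → ℝ}
    (hX : IsEllipticExploding P X 1 C) :
    HasMomentLimits P (fun N ω => (1 / √(N : ℝ)) • X N ω) C where
  elliptic N :=
    { measurable := fun i j => (hX.measurable N i j).const_mul _
      moments := fun i j => (HasAllMoments.of_integrable_pow (hX.measurable N i j)
        (hX.integrable_pow N i j)).const_mul _
      mean := fun i j => by
        simp only [Matrix.smul_apply, smul_eq_mul]
        rw [integral_const_mul, hX.mean, mul_zero]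
      indep := (hX.indep N).comp
        (fun _ x => (1 / √(N : ℝ) * x.1, 1 / √(N : ℝ) * x.2)) fun _ => by fun_prop }
  offDiag k l hkl := by
    rw [Metric.tendsto_nhds]
    intro ε hε
    rw [eventually_comap_fst]
    filter_upwards [hX.offDiag k l hkl ε hε, eventually_gt_atTop 0] with N h hN p
    rw [Real.dist_eq]
    convert! h p.1.1 p.1.2 p.2 using 3
    simp only [Matrix.smul_apply, smul_eq_mul, mul_pow]
    rw [div_eq_inv_mul (∫ _, _ ∂_), ← Nat.cast_add, ← natCast_mul_one_div_sqrt_pow hN, pow_add,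
      mul_assoc (N : ℝ), ← integral_const_mul ((1 / √(N : ℝ)) ^ k * _)]
    refine congrArg (fun x => (N : ℝ) * x) (integral_congr_ae (Eventually.of_forall fun ω => ?_))
    dsimp only
    ring
  diag k hk := by
    obtain ⟨K, hK⟩ := hX.diag k hk
    refine ⟨K, ?_⟩
    filter_upwards [hK, eventually_gt_atTop 0] with N h hN i
    refine le_trans ?_ (h i)
    simp only [Matrix.smul_apply, smul_eq_mul, mul_pow]
    have h0 : 0 ≤ ((N : ℝ) ^ ((k : ℝ) / 2 - 1))⁻¹ := by positivity
    rw [integral_const_mul, ← mul_assoc, natCast_mul_one_div_sqrt_pow hN, abs_mul,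
      abs_of_nonneg h0, div_eq_inv_mul (∫ _, _ ∂_)]
    refine mul_le_mul_of_nonneg_left ?_ h0
    refine abs_integral_le_integral_abs.trans_eq ?_
    simp_rw [abs_pow]

lemma Multidigraph.Z_eq_fluctuation {Ω : ℕ → Type*} [∀ N, MeasurableSpace (Ω N)]
    {P : ∀ N, Measure (Ω N)} [∀ N, IsProbabilityMeasure (P N)]
    {X : ∀ N, Ω N → Matrix (Fin N) (Fin N) ℝ}
    {N : ℕ} (hA : IsEllipticMatrix (P N) fun ω => (1 / √(N : ℝ)) • X N ω)
    (T : Multidigraph) :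
    T.Z P X N = fluctuation (P N) (fun ω => (1 / √(N : ℝ)) • X N ω) T := by
  funext ω
  have h (ω) : T.tau ((1 / √(N : ℝ)) • X N ω) = 1 / (N : ℝ) *
    ∑ φ : T.V ↪ Fin N, monomial ((1 / √(N : ℝ)) • X N ω) (T.positions φ) Finset.univ := rfl
  unfold Z fluctuation centeredMonomial
  simp_rw [h]
  rw [integral_const_mul, integral_finsetSum _ fun φ _ =>
      (IsEllipticMatrix.hasAllMoments_monomial hA _ _).integrable, ← mul_sub, ← Finset.sum_sub_distrib, ← mul_assoc,
    mul_one_div, Real.sqrt_div_self', one_div]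

/-! ### The limiting covariance is symmetric and positive semidefinite -/

section Limit

variable {Ω : ℕ → Type*} [∀ N, MeasurableSpace (Ω N)] {P : ∀ N, Measure (Ω N)}
  [∀ N, IsProbabilityMeasure (P N)] {A : ∀ N, Ω N → Matrix (Fin N) (Fin N) ℝ} {C : ℕ → ℕ → ℝ}

/-- Inherited from the prelimit covariances, which avoids a bijection between gluings and a
comparison of numberings. -/
lemma HasMomentLimits.limitCov_comm (hA : HasMomentLimits P A C)
    (ν : ∀ T : Multidigraph, T.V ≃ Fin (Fintype.card T.V)) (π₁ π₂ : CyclePartition) :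
    limitCov C ν π₁ π₂ = limitCov C ν π₂ π₁ :=
  tendsto_nhds_unique (hA.tendsto_covariance ν π₁ π₂) <|
    (hA.tendsto_covariance ν π₂ π₁).congr fun N => by simp_rw [mul_comm]

lemma HasMomentLimits.limitCov_nonneg (hA : HasMomentLimits P A C)
    (ν : ∀ T : Multidigraph, T.V ≃ Fin (Fintype.card T.V)) (c : CyclePartition →₀ ℝ) :
    0 ≤ c.sum fun π₁ a => c.sum fun π₂ b => a * b * limitCov C ν π₁ π₂ := by
  have h : Tendsto (fun N => ∑ π₁ ∈ c.support, ∑ π₂ ∈ c.support, c π₁ * c π₂ *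
      ∫ ω, fluctuation (P N) (A N) (partitionGraph π₁) ω *
        fluctuation (P N) (A N) (partitionGraph π₂) ω ∂(P N)) atTop
      (𝓝 (c.sum fun π₁ a => c.sum fun π₂ b => a * b * limitCov C ν π₁ π₂)) :=
    tendsto_finsetSum _ fun π₁ _ => tendsto_finsetSum _ fun π₂ _ =>
      (hA.tendsto_covariance ν π₁ π₂).const_mul _
  refine ge_of_tendsto' h fun N => ?_
  have : ∑ π₁ ∈ c.support, ∑ π₂ ∈ c.support, c π₁ * c π₂ *
      ∫ ω, fluctuation (P N) (A N) (partitionGraph π₁) ω *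
        fluctuation (P N) (A N) (partitionGraph π₂) ω ∂(P N) =
      ∫ ω, (∑ π ∈ c.support, c π * fluctuation (P N) (A N) (partitionGraph π) ω) ^ 2 ∂(P N) := by
    simp_rw [← integral_const_mul, sq, Finset.sum_mul_sum]
    have hint' : ∀ π₁ π₂, Integrable (fun ω =>
        c π₁ * fluctuation (P N) (A N) (partitionGraph π₁) ω *
          (c π₂ * fluctuation (P N) (A N) (partitionGraph π₂) ω)) (P N) := fun π₁ π₂ =>
      (((hasAllMoments_fluctuation (hA.elliptic N) _).const_mul _).mul
        ((hasAllMoments_fluctuation (hA.elliptic N) _).const_mul _)).integrable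
    rw [integral_finsetSum _ fun π₁ _ => integrable_finsetSum _ fun π₂ _ => hint' π₁ π₂]
    refine Finset.sum_congr rfl fun π₁ _ => ?_
    rw [integral_finsetSum _ fun π₂ _ => hint' π₁ π₂]
    refine Finset.sum_congr rfl fun π₂ _ => integral_congr_ae (Eventually.of_forall fun ω => ?_)
    dsimp only
    ring
  rw [this]
  positivity

end Limit

/-! ### Moments of linear combinations -/

/-- For a fixed pairing the sum over index tuples factorizes, each pair giving the variance of the
linear combination. -/
lemma sum_prod_mul_wickSum {I J : Type} [Fintype J] (K : I → I → ℝ) (p : J → I) (t : J → ℝ)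
    (r : ℕ) [DecidablePred (IsPairing (r := r))] :
    ∑ f : Fin r → J, (∏ i, t (f i)) * wickSum K (fun i => p (f i)) =
      ∑ s : Equiv.Perm (Fin r) with IsPairing s,
        (∑ j, ∑ j', t j * t j' * K (p j) (p j')) ^ (Finset.univ.filter fun i => i < s i).card := by
  have h : ∀ f : Fin r → J, wickSum K (fun i => p (f i)) =
      ∑ s : Equiv.Perm (Fin r) with IsPairing s, ∏ i with i < s i, K (p (f i)) (p (f (s i))) := by
    intro f
    unfold wickSum
    refine Finset.sum_congr (Finset.ext fun s => ?_) fun _ _ => rfl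
    rw [Finset.mem_filter, Finset.mem_filter]
    rfl
  simp_rw [h, Finset.mul_sum]
  rw [Finset.sum_comm]
  refine Finset.sum_congr rfl fun s hs => ?_
  have hs : IsPairing s := (Finset.mem_filter.1 hs).2
  rw [← Finset.prod_const, hs.prod_sum_eq (A := fun _ => J)
    fun i j j' => t j * t j' * K (p j) (p j')]
  refine Finset.sum_congr rfl fun f _ => ?_
  rw [hs.prod_eq, ← Finset.prod_mul_distrib]

/-! ### The central limit theorem -/

section CLT

variable {Ω : ℕ → Type*} [∀ N, MeasurableSpace (Ω N)] {P : ∀ N, Measure (Ω N)}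
  [∀ N, IsProbabilityMeasure (P N)] {A : ∀ N, Ω N → Matrix (Fin N) (Fin N) ℝ} {C : ℕ → ℕ → ℝ}

lemma HasMomentLimits.tendsto_integral_cexp (hA : HasMomentLimits P A C)
    (ν : ∀ T : Multidigraph, T.V ≃ Fin (Fintype.card T.V)) {J : Type} [Fintype J]
    (p : J → CyclePartition) (t : J → ℝ) :
    Tendsto (fun N => ∫ ω, Complex.exp
        ((∑ j, t j * fluctuation (P N) (A N) (partitionGraph (p j)) ω : ℝ) * Complex.I) ∂(P N))
      atTop (𝓝 (Complex.exp
        (-((∑ j, ∑ j', t j * t j' * limitCov C ν (p j) (p j') : ℝ) : ℂ) / 2))) := by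
  classical
  have hY : ∀ N, HasAllMoments (P N)
      (fun ω => ∑ j, t j * fluctuation (P N) (A N) (partitionGraph (p j)) ω) := fun N =>
    HasAllMoments.sum _ fun j _ => (hasAllMoments_fluctuation (hA.elliptic N) _).const_mul _
  refine tendsto_integral_cexp_of_moments hY (m := fun r => ∑ f : Fin r → J, (∏ i, t (f i)) *
    wickSum (limitCov C ν) (fun i => p (f i))) (fun r => ?_) (fun n => ?_) (fun n => ?_)
  · have hpow : ∀ N, ∫ ω, (∑ j, t j * fluctuation (P N) (A N) (partitionGraph (p j)) ω) ^ r ∂(P N) =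
        ∑ f : Fin r → J, (∏ i, t (f i)) *
          ∫ ω, ∏ i, fluctuation (P N) (A N) (partitionGraph (p (f i))) ω ∂(P N) := by
      intro N
      simp_rw [Fintype.sum_pow, Finset.prod_mul_distrib]
      rw [integral_finsetSum _ fun f _ => ((HasAllMoments.prod _ fun i _ =>
        hasAllMoments_fluctuation (hA.elliptic N) _).const_mul _).integrable]
      simp_rw [integral_const_mul]
    simp_rw [hpow]
    exact tendsto_finsetSum _ fun f _ => (hA.tendsto_wickSum ν fun i => p (f i)).const_mul _
  -- A pairing of `r` points forces `r` to be even, so the sum is empty.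
  · rw [sum_prod_mul_wickSum]
    refine Finset.sum_eq_zero fun s hs => ?_
    have := (Finset.mem_filter.1 hs).2.two_mul_card
    omega
  · rw [sum_prod_mul_wickSum, ← card_isPairing, ← nsmul_eq_mul]
    refine Finset.sum_eq_card_nsmul fun s hs => ?_
    have := (Finset.mem_filter.1 hs).2.two_mul_card
    rw [show (Finset.univ.filter fun i => i < s i).card = n by omega]

/-- Lévy's continuity theorem needs an inner product, so the marginals are viewed in Euclidean space
through `WithLp.toLp 2` and carried back by a continuous map. -/
lemma HasMomentLimits.tendstoInDistribution (hA : HasMomentLimits P A C)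
    (ν : ∀ T : Multidigraph, T.V ≃ Fin (Fintype.card T.V))
    {Ω' : Type} [MeasurableSpace Ω'] {P' : Measure Ω'} [IsProbabilityMeasure P']
    {z : CyclePartition → Ω' → ℝ} (hz : IsGaussianProcess z P') (hz0 : ∀ π, ∫ ω, z π ω ∂P' = 0)
    (hcov : ∀ π₁ π₂, cov[z π₁, z π₂; P'] = limitCov C ν π₁ π₂) (I : Finset CyclePartition) :
    TendstoInDistribution
      (fun N ω (π : I) => fluctuation (P N) (A N) (partitionGraph π) ω) atTop
      (fun ω (π : I) => z π ω) P P' := by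
  have hlaw : HasGaussianLaw (fun ω => WithLp.toLp 2 fun π : I => z π ω) P' :=
    (hz.hasGaussianLaw I).toLp_pi 2
  have hlp : ∀ π, MemLp (z π) 2 P' := fun π => (hz.hasGaussianLaw_eval π).memLp_two
  have hmeas : ∀ N, AEMeasurable (fun ω => WithLp.toLp 2 fun π : I =>
      fluctuation (P N) (A N) (partitionGraph π) ω) (P N) := fun N =>
    (WithLp.measurable_toLp 2 _).comp_aemeasurable <| aemeasurable_pi_lambda _ fun π =>
      (hasAllMoments_fluctuation (hA.elliptic N) _).integrable.aemeasurable
  have hE : TendstoInDistribution (fun N ω => WithLp.toLp 2 fun π : I =>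
      fluctuation (P N) (A N) (partitionGraph π) ω) atTop
      (fun ω => WithLp.toLp 2 fun π : I => z π ω) P P' :=
    { forall_aemeasurable := hmeas
      aemeasurable_limit := hlaw.aemeasurable
      tendsto := by
        refine ProbabilityMeasure.tendsto_of_tendsto_charFun fun t => ?_
        have hinner : ∀ x : I → ℝ, inner ℝ t (WithLp.toLp 2 x) = ∑ π : I, t π * x π := by
          intro x
          simp [PiLp.inner_apply, mul_comm]
        have h1 : ∀ N, charFun ((P N).map fun ω => WithLp.toLp 2 fun π : I =>
            fluctuation (P N) (A N) (partitionGraph π) ω) t = ∫ ω, Complex.exp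
            ((∑ π : I, t π * fluctuation (P N) (A N) (partitionGraph π) ω : ℝ) *
              Complex.I) ∂(P N) := by
          intro N
          rw [charFun_apply, integral_map (hmeas N) (by fun_prop)]
          simp_rw [real_inner_comm, hinner]
        have h2 : charFun (P'.map fun ω => WithLp.toLp 2 fun π : I => z π ω) t = Complex.exp
            (-((∑ π : I, ∑ π' : I, t π * t π' * limitCov C ν π π' : ℝ) : ℂ) / 2) := by
          rw [hlaw.charFun_map_eq]
          simp_rw [hinner]
          rw [integral_finsetSum _ fun (π : I) _ => ((hlp π).integrable one_le_two).const_mul (t π),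
            variance_fun_sum fun (π : I) => (hlp π).const_mul (t π)]
          simp_rw [integral_const_mul, hz0, covariance_const_mul_left, covariance_const_mul_right,
            hcov, mul_assoc]
          simp [neg_div]
        simp only [ProbabilityMeasure.coe_mk]
        rw [h2]
        simp_rw [h1]
        exact hA.tendsto_integral_cexp ν (fun π : I => (π : CyclePartition)) fun π => t π }
  exact hE.continuous_comp (g := WithLp.ofLp) (PiLp.continuous_ofLp 2 _)

end CLT

theorem mainTheorem1 {Ω : ℕ → Type*} [∀ N, MeasurableSpace (Ω N)]
    (P : ∀ N, Measure (Ω N)) [∀ N, IsProbabilityMeasure (P N)]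
    (X : ∀ N, Ω N → Matrix (Fin N) (Fin N) ℝ) (C : ℕ → ℕ → ℝ)
    (hX : IsEllipticExploding P X 1 C)
    (ν : ∀ T : Multidigraph, T.V ≃ Fin (Fintype.card T.V)) :
    (∃ (Ω' : Type) (_ : MeasurableSpace Ω') (P' : Measure Ω') (_ : IsProbabilityMeasure P')
      (z : CyclePartition → Ω' → ℝ),
      IsGaussianProcess z P' ∧
      (∀ π, ∫ ω, z π ω ∂P' = 0) ∧
      (∀ π₁ π₂, cov[z π₁, z π₂; P'] = limitCov C ν π₁ π₂) ∧
      ∀ I : Finset CyclePartition,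
        TendstoInDistribution
          (fun N ω (π : I) => (partitionGraph π).Z P X N ω) atTop
          (fun ω (π : I) => z π ω) P P') ∧
    (∀ (r : ℕ) (π : Fin r → CyclePartition),
      (∀ N, Integrable (fun ω => ∏ j, (partitionGraph (π j)).Z P X N ω) (P N)) ∧
      Tendsto (fun N => ∫ ω, ∏ j, (partitionGraph (π j)).Z P X N ω ∂(P N)) atTop
        (𝓝 (wickSum (limitCov C ν) π))) := by
  have hA := hX.hasMomentLimits
  have hZ : ∀ N π, (partitionGraph π).Z P X N =
      fluctuation (P N) (fun ω => (1 / √(N : ℝ)) • X N ω) (partitionGraph π) := fun N π =>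
    Multidigraph.Z_eq_fluctuation (hA.elliptic N) _
  simp_rw [hZ]
  refine ⟨?_, fun r π => ⟨fun N => ?_, hA.tendsto_wickSum ν π⟩⟩
  · obtain ⟨z, hz, hz0, hcov⟩ := exists_gaussianProcess (limitCov C ν) (hA.limitCov_comm ν)
      (hA.limitCov_nonneg ν)
    exact ⟨ℕ → ℝ, inferInstance, iidGaussian, inferInstance, z, hz, hz0, hcov,
      hA.tendstoInDistribution ν hz hz0 hcov⟩
  · exact (HasAllMoments.prod _ fun j _ => hasAllMoments_fluctuation (hA.elliptic N) _).integrable
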